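/- Let $\{X_n, n\ge 1\}$ be a sequence of independent and identically distributed random variables with values in a countable alphabet whose letters are labelled $1,2,3,\dots$, and let $p_i=p(i)=P(X_1=i)$, $i\ge 1$ (some $p_i$ may be $0$). Assume that $\{p_i\}$ is nonuniform, i.e. it is not constant on its support $\{i: p_i>0\}$. Let $0<\delta<\frac12$, assume $E|\ln p(X_1)|^{2+\delta}<\infty$, and assume that there are an integer valued function $K(n)$ and a constant $C_0$ such that, for all $n\ge 1$, $$K(n)\le n^{\frac12-\delta},\qquad n^{\frac12+\delta}\ln n\sum_{i\ge K(n)}p_i\le C_0,\qquad -n^{\frac12+\delta}\sum_{i\ge K(n)}p_i\ln p_i\le C_0,$$ where $i$ ranges over the letters $i\ge 1$ and $0\ln 0=0$. Assume moreover that $\sum_{i=1}^\infty p_i^{1-\epsilon}<\infty$ for some $\epsilon\in(\frac12,1)$ (letters with $p_i=0$ contribute $0$). Let $H=-\sum_{i=1}^\infty p_i\ln p_i$ be Shannon's entropy and $\sigma^2=\mathrm{Var}(\ln p(X_1))$, $\sigma\ge 0$. For $n\ge 2$ let $\hat p_i=\frac1n\sum_{k=1}^n I_{\{X_k=i\}}$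 and $\hat H_n=-\sum_{i=1}^\infty\hat p_i\ln\hat p_i$; for $1\le j\le n$ let $\hat p_i^{(j)}=\frac1{n-1}\bigl(\sum_{k=1}^n I_{\{X_k=i\}}-I_{\{X_j=i\}}\bigr)$ and $\hat H_n^{(j)}=-\sum_{i=1}^\infty\hat p_i^{(j)}\ln\hat p_i^{(j)}$; and let $$\hat H_{JK}=n\hat H_n-(n-1)\,\frac{\sum_{j=1}^n\hat H_n^{(j)}}{n}$$ be the jackknife entropy estimator. Then there is a constant $C$, not depending on $n$, such that for all $n\ge 2$ $$\sup_{x\in\mathbb R}\left|P\left(\frac{\sqrt n}{\sigma}(\hat H_{JK}-H)\le x\right)-\Phi(x)\right|\le Cn^{-\frac{\delta}{2}}+Cn^{\frac14-\frac{\epsilon}{2}},$$ where $\Phi$ is the standard normal distribution function. -/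

import Mathlib

open MeasureTheory ProbabilityTheory

noncomputable section

/-- The alphabet, labelled by the positive integers, carries its discrete σ-algebra. -/
instance instMeasurableSpaceLetters : MeasurableSpace ℕ+ := ⊤

/-- Shannon's entropy `-∑ qᵢ ln qᵢ` (natural logarithm, `0 ln 0 = 0`) of `q = {qᵢ, i ≥ 1}`. -/
def shannonEntropy (q : ℕ+ → ℝ) : ℝ := -∑' i, q i * Real.log (q i)

/-- The distribution `{pᵢ, i ≥ 1}` is nonuniform: it does not assign one and the same
probability to all the letters in its support. -/
def IsNonuniform (p : ℕ+ → ℝ) : Prop := ∃ i j, p i ≠ 0 ∧ p j ≠ 0 ∧ p i ≠ p j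

/-- The indicator of the event that an observation `y` is the letter `i`. -/
def letterInd (y i : ℕ+) : ℝ := if y = i then 1 else 0

/-- The sample proportions of the first `n` observations `x 0, …, x (n - 1)`. -/
def sampleProp (n : ℕ) (x : ℕ → ℕ+) (i : ℕ+) : ℝ :=
  (1 / (n : ℝ)) * ∑ k ∈ Finset.range n, letterInd (x k) i

/-- The sample proportions of `x 0, …, x (n - 1)` with the observation `x j` deleted. -/
def looSampleProp (n : ℕ) (x : ℕ → ℕ+) (j : ℕ) (i : ℕ+) : ℝ :=
  (1 / ((n : ℝ) - 1)) * (∑ k ∈ Finset.range n, letterInd (x k) i - letterInd (x j) i)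

/-- The plug-in entropy estimator based on the first `n` observations. -/
def plugInEntropy (n : ℕ) (x : ℕ → ℕ+) : ℝ := shannonEntropy (sampleProp n x)

/-- The jackknife entropy estimator based on the first `n` observations (`n ≥ 2`). -/
def jackknifeEntropy (n : ℕ) (x : ℕ → ℕ+) : ℝ :=
  (n : ℝ) * plugInEntropy n x -
    ((n : ℝ) - 1) * ((∑ j ∈ Finset.range n, shannonEntropy (looSampleProp n x j)) / (n : ℝ))

/-- The tail sum `∑_{i ≥ k} f i` over the letters `i ≥ 1`. -/
def tailSum (k : ℤ) (f : ℕ+ → ℝ) : ℝ := ∑' i : {i : ℕ+ // k ≤ ((i : ℕ) : ℤ)}, f i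

end

/-!
The jackknife estimator is compared with the oracle average `n⁻¹ ∑ₖ -ln p(Xₖ)`. The summability of
`p i ^ (1 - ε)` gives `ln p(X₁)` moments of every order, so the oracle average, standardized, is
within `O(n ^ (-1/4))` of the normal distribution by Esseen's smoothing inequality. The two
estimators differ by `O(n ^ (-ε))` in mean: the jackknife correction of the plug-in entropy is a sum
of Jensen gaps and lies between `0` and `1 / n` times the number of observed letters, while the
plug-in entropy is at most the oracle average (Gibbs) and falls short of it by the mean of
`ln (q / p)` over the sample, where `q` are the sample proportions. Splitting this logarithm at
`p + 1 / n` bounds it by `ln (1 + 1 / (n p))` plus `q / (p + 1 / n) - 1`, and the expected sample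
mean of the last term is at most `0`. Perturbing the normal approximation on the scale
`n ^ (1/4 - ε/2)`, where Markov's inequality balances the two errors, yields the rate.
-/

lemma measureReal_le_le_add {Ω : Type*} [MeasurableSpace Ω] {μ : Measure Ω} [IsFiniteMeasure μ]
    {V W : Ω → ℝ} (x η : ℝ) :
    μ.real {ω | V ω ≤ x} ≤ μ.real {ω | W ω ≤ x + η} + μ.real {ω | η < |V ω - W ω|} := by
  refine (measureReal_mono fun ω (hω : V ω ≤ x) => ?_).trans (measureReal_union_le _ _)
  rcases lt_or_ge η |V ω - W ω| with h | h
  · exact Or.inr h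
  · exact Or.inl (show W ω ≤ x + η by linarith [neg_le_of_abs_le h])

section GaussianSmoothing

open Set Filter Complex
open scoped NNReal Topology

lemma integral_charFun_comm {E : Type*} [NormedAddCommGroup E] [InnerProductSpace ℝ E]
    [MeasurableSpace E] [OpensMeasurableSpace E] [SecondCountableTopology E]
    (κ γ : Measure E) [IsFiniteMeasure κ] [IsFiniteMeasure γ] :
    ∫ t, charFun γ t ∂κ = ∫ x, charFun κ x ∂γ := by
  have hint : Integrable (Function.uncurry fun t x : E => cexp ((inner ℝ x t : ℝ) * I))
      (κ.prod γ) := by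
    refine Integrable.of_bound (C := 1) ?_ (ae_of_all _ fun p => ?_)
    · exact Measurable.aestronglyMeasurable (by unfold Function.uncurry; fun_prop)
    · exact (norm_exp_ofReal_mul_I _).le
  simp_rw [charFun_apply]
  rw [integral_integral_swap hint]
  simp_rw [real_inner_comm]

lemma gaussianPDFReal_eq_charFun {v : ℝ≥0} (hv : v ≠ 0) (x u : ℝ) :
    (gaussianPDFReal x v u : ℂ) =
      ((√(2 * Real.pi * v))⁻¹ : ℝ) * charFun (gaussianReal 0 v⁻¹) (-x + u) := by
  have hv' : (v : ℂ) ≠ 0 := by exact_mod_cast hv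
  rw [charFun_gaussianReal, gaussianPDFReal]
  push_cast
  congr 2
  field_simp
  ring

lemma measureReal_conv_gaussianReal {ν : Measure ℝ} {v : ℝ≥0} (hv : v ≠ 0) {s : Set ℝ}
    (hs : MeasurableSet s) :
    (ν ∗ gaussianReal 0 v).real s = ∫ x, (∫ u in s, gaussianPDFReal x v u) ∂ν := by
  have hfiber (x : ℝ) : gaussianReal 0 v ((x + ·) ⁻¹' s) = gaussianReal x v s := by
    rw [← Measure.map_apply (by fun_prop) hs, gaussianReal_map_const_add, zero_add]
  have hreal (x : ℝ) : (gaussianReal x v s).toReal = ∫ u in s, gaussianPDFReal x v u := by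
    rw [gaussianReal_apply_eq_integral _ hv, ENNReal.toReal_ofReal]
    exact integral_nonneg fun u => gaussianPDFReal_nonneg _ _ _
  have hmeas : Measurable fun x : ℝ => gaussianReal x v s :=
    (Measure.measurable_coe hs).comp (by fun_prop : Measurable fun x : ℝ => gaussianReal x v)
  rw [Measure.real, Measure.conv, Measure.map_apply (by fun_prop) hs,
    Measure.prod_apply (hs.preimage (by fun_prop))]
  simp_rw [← hreal]
  rw [integral_toReal hmeas.aemeasurable (ae_of_all _ fun x => measure_lt_top _ _)]
  exact congrArg ENNReal.toReal (lintegral_congr hfiber)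

lemma measureReal_conv_gaussianReal_eq_integral_charFun {ν : Measure ℝ} [IsFiniteMeasure ν]
    {v : ℝ≥0} (hv : v ≠ 0) {s : Set ℝ} (hs : MeasurableSet s)
    [IsFiniteMeasure (volume.restrict s)] :
    ((ν ∗ gaussianReal 0 v).real s : ℂ) = ((√(2 * Real.pi * v))⁻¹ : ℝ) *
      ∫ t, charFun ν (-t) * charFun (volume.restrict s) t ∂gaussianReal 0 v⁻¹ := by
  have hint (κ : Measure ℝ) [IsFiniteMeasure κ] :
      Integrable (charFun (gaussianReal 0 v⁻¹)) κ :=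
    Integrable.of_bound (C := 1) measurable_charFun.aestronglyMeasurable
      (ae_of_all _ norm_charFun_le_one)
  have hneg (t : ℝ) : charFun (ν.map (-1 * ·)) t = charFun ν (-t) := by
    rw [charFun_map_mul, neg_one_mul]
  calc ((ν ∗ gaussianReal 0 v).real s : ℂ)
      = ((√(2 * Real.pi * v))⁻¹ : ℝ) *
        ∫ x, (∫ u in s, charFun (gaussianReal 0 v⁻¹) (-x + u)) ∂ν := by
        rw [measureReal_conv_gaussianReal hv hs, ← integral_complex_ofReal]
        simp_rw [← integral_complex_ofReal, gaussianPDFReal_eq_charFun hv, integral_const_mul]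
    _ = ((√(2 * Real.pi * v))⁻¹ : ℝ) *
        ∫ y, charFun (gaussianReal 0 v⁻¹) y ∂(ν.map (-1 * ·) ∗ volume.restrict s) := by
        rw [integral_conv (hint _),
          (measurableEmbedding_mulLeft₀ (neg_ne_zero.2 one_ne_zero)).integral_map]
        simp_rw [neg_one_mul]
    _ = _ := by
        rw [integral_charFun_comm]
        simp_rw [charFun_conv, hneg]

lemma norm_charFun_restrict_Ioc_le {a b : ℝ} (hab : a ≤ b) {t : ℝ} (ht : t ≠ 0) :
    ‖charFun (volume.restrict (Ioc a b)) t‖ ≤ 2 / |t| := by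
  have hc : (t * I : ℂ) ≠ 0 := by simp [ht]
  have hcomm (u : ℝ) : cexp (t * u * I) = cexp (t * I * u) := by congr 1; ring
  have hexp (u : ℝ) : ‖cexp (t * I * u)‖ = 1 := by
    rw [← hcomm, ← ofReal_mul, norm_exp_ofReal_mul_I]
  rw [charFun_apply_real, ← intervalIntegral.integral_of_le hab]
  simp_rw [hcomm]
  rw [integral_exp_mul_complex hc, norm_div, norm_mul, norm_I, mul_one, norm_real,
    Real.norm_eq_abs]
  gcongr
  refine (norm_sub_le _ _).trans_eq ?_
  rw [hexp, hexp]
  norm_num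

lemma abs_conv_gaussianReal_Ioc_sub_le {ν ρ : Measure ℝ} [IsProbabilityMeasure ν]
    [IsProbabilityMeasure ρ] {v : ℝ≥0} (hv : v ≠ 0) {g : ℝ → ℝ}
    (hg : Integrable g (gaussianReal 0 v⁻¹))
    (hle : ∀ t, 2 * ‖charFun ν t - charFun ρ t‖ ≤ |t| * g t) {a b : ℝ} (hab : a ≤ b) :
    |(ν ∗ gaussianReal 0 v).real (Ioc a b) - (ρ ∗ gaussianReal 0 v).real (Ioc a b)| ≤
      (√(2 * Real.pi * v))⁻¹ * ∫ t, g t ∂gaussianReal 0 v⁻¹ := by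
  have hint (κ : Measure ℝ) [IsProbabilityMeasure κ] : Integrable (fun t : ℝ =>
      charFun κ (-t) * charFun (volume.restrict (Ioc a b)) t) (gaussianReal 0 v⁻¹) := by
    refine Integrable.of_bound (C := 1 * (volume.restrict (Ioc a b)).real univ)
      ((measurable_charFun.comp measurable_neg).mul measurable_charFun).aestronglyMeasurable
      (ae_of_all _ fun t => ?_)
    rw [norm_mul]
    gcongr
    exacts [norm_charFun_le_one _, norm_charFun_le _]
  rw [← Real.norm_eq_abs, ← Complex.norm_real, ofReal_sub,
    measureReal_conv_gaussianReal_eq_integral_charFun hv measurableSet_Ioc,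
    measureReal_conv_gaussianReal_eq_integral_charFun hv measurableSet_Ioc,
    ← mul_sub, ← integral_sub (hint ν) (hint ρ), norm_mul, Complex.norm_real,
    Real.norm_of_nonneg (by positivity)]
  gcongr
  refine norm_integral_le_of_norm_le hg ?_
  have := nullSingletonClass_gaussianReal (μ := 0) (inv_ne_zero hv)
  filter_upwards [Measure.ae_ne (gaussianReal 0 v⁻¹) 0] with t ht
  have ht' : 0 < |t| := abs_pos.2 ht
  rw [← sub_mul, norm_mul, charFun_neg, charFun_neg, ← map_sub, RCLike.norm_conj]
  calc _ ≤ ‖charFun ν t - charFun ρ t‖ * (2 / |t|) := by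
        gcongr
        exact norm_charFun_restrict_Ioc_le hab ht
    _ = 2 * ‖charFun ν t - charFun ρ t‖ / |t| := by ring
    _ ≤ |t| * g t / |t| := div_le_div_of_nonneg_right (hle t) ht'.le
    _ = g t := by field_simp

lemma abs_conv_gaussianReal_Iic_sub_le {ν ρ : Measure ℝ} [IsProbabilityMeasure ν]
    [IsProbabilityMeasure ρ] {v : ℝ≥0} (hv : v ≠ 0) {g : ℝ → ℝ}
    (hg : Integrable g (gaussianReal 0 v⁻¹))
    (hle : ∀ t, 2 * ‖charFun ν t - charFun ρ t‖ ≤ |t| * g t) (b : ℝ) :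
    |(ν ∗ gaussianReal 0 v).real (Iic b) - (ρ ∗ gaussianReal 0 v).real (Iic b)| ≤
      (√(2 * Real.pi * v))⁻¹ * ∫ t, g t ∂gaussianReal 0 v⁻¹ := by
  have hlim (κ : Measure ℝ) [IsProbabilityMeasure κ] :
      Tendsto (fun a => κ.real (Ioc a b)) atBot (𝓝 (κ.real (Iic b))) :=
    (ENNReal.tendsto_toReal (measure_ne_top _ _)).comp (tendsto_measure_Ioc_atBot κ b)
  exact le_of_tendsto ((hlim (ν ∗ gaussianReal 0 v)).sub (hlim (ρ ∗ gaussianReal 0 v))).abs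
    ((eventually_le_atBot b).mono fun a hab => abs_conv_gaussianReal_Ioc_sub_le hv hg hle hab)

lemma gaussianReal_le_smul_volume (m : ℝ) {v : ℝ≥0} (hv : v ≠ 0) :
    gaussianReal m v ≤ ENNReal.ofReal (√(2 * Real.pi * v))⁻¹ • volume := by
  rw [gaussianReal_of_var_ne_zero m hv, ← withDensity_const]
  refine withDensity_mono (ae_of_all _ fun x => ENNReal.ofReal_le_ofReal ?_)
  refine mul_le_of_le_one_right (by positivity) (Real.exp_le_one_iff.2 ?_)
  exact div_nonpos_of_nonpos_of_nonneg (neg_nonpos.2 (sq_nonneg _)) (by positivity)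

lemma integrable_gaussianReal {f : ℝ → ℝ} (hf : Integrable f) (m : ℝ) {v : ℝ≥0} (hv : v ≠ 0) :
    Integrable f (gaussianReal m v) :=
  (hf.smul_measure ENNReal.ofReal_ne_top).mono_measure (gaussianReal_le_smul_volume m hv)

lemma integral_gaussianReal_inv_le_integral {f : ℝ → ℝ} (hf : Integrable f) (hf0 : 0 ≤ f)
    {v : ℝ≥0} (hv : v ≠ 0) :
    (√(2 * Real.pi * v))⁻¹ * ∫ t, f t ∂gaussianReal 0 v⁻¹ ≤ ∫ t, f t := by
  have : (0 : ℝ) < v := by positivity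
  have hnorm : (√(2 * Real.pi * v))⁻¹ * (√(2 * Real.pi * (v⁻¹ : ℝ≥0)))⁻¹ = (2 * Real.pi)⁻¹ := by
    rw [← mul_inv, ← Real.sqrt_mul (by positivity),
      show 2 * Real.pi * v * (2 * Real.pi * (v⁻¹ : ℝ≥0)) = (2 * Real.pi) ^ 2 by
        push_cast; field_simp, Real.sqrt_sq (by positivity)]
  have hle : ∫ t, f t ∂gaussianReal 0 v⁻¹ ≤ (√(2 * Real.pi * (v⁻¹ : ℝ≥0)))⁻¹ * ∫ t, f t := by
    refine (integral_mono_measure (gaussianReal_le_smul_volume 0 (inv_ne_zero hv))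
      (ae_of_all _ hf0) (hf.smul_measure ENNReal.ofReal_ne_top)).trans_eq ?_
    rw [integral_smul_measure, ENNReal.toReal_ofReal (by positivity), smul_eq_mul]
  calc _ ≤ (√(2 * Real.pi * v))⁻¹ * ((√(2 * Real.pi * (v⁻¹ : ℝ≥0)))⁻¹ * ∫ t, f t) := by gcongr
    _ = (2 * Real.pi)⁻¹ * ∫ t, f t := by rw [← mul_assoc, hnorm]
    _ ≤ ∫ t, f t := mul_le_of_le_one_left (integral_nonneg hf0)
        (inv_le_one_of_one_le₀ (by linarith [Real.pi_gt_three]))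

lemma gaussianReal_Iic_add_le (x : ℝ) {d : ℝ} (hd : 0 ≤ d) :
    (gaussianReal 0 1).real (Iic (x + d)) ≤ (gaussianReal 0 1).real (Iic x) + d := by
  have hIoc : (gaussianReal 0 1).real (Ioc x (x + d)) ≤ d := by
    have h := gaussianReal_le_smul_volume 0 one_ne_zero (Ioc x (x + d))
    rw [Measure.smul_apply, Real.volume_Ioc, add_sub_cancel_left, smul_eq_mul,
      ← ENNReal.ofReal_mul (by positivity)] at h
    refine (ENNReal.toReal_le_of_le_ofReal (by positivity) h).trans ?_
    refine mul_le_of_le_one_left hd (inv_le_one_of_one_le₀ (Real.one_le_sqrt.2 ?_))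
    push_cast
    linarith [Real.pi_gt_three]
  rw [← Iic_union_Ioc_eq_Iic (le_add_of_nonneg_right hd)]
  exact (measureReal_union_le _ _).trans (by gcongr)

lemma gaussianReal_lt_abs_le (v : ℝ≥0) {a : ℝ} (ha : 0 < a) :
    (gaussianReal 0 v).real {y | a < |y|} ≤ v / a ^ 2 := by
  have h := meas_ge_le_variance_div_sq (memLp_id_gaussianReal (μ := 0) (v := v) 2) ha
  simp only [variance_id_gaussianReal, id_eq, integral_id_gaussianReal, sub_zero] at h
  exact (measureReal_mono fun y (hy : a < |y|) => hy.le).trans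
    (ENNReal.toReal_le_of_le_ofReal (by positivity) h)

lemma measureReal_prod_fst_le (ν γ : Measure ℝ) [IsProbabilityMeasure γ] (x : ℝ) :
    (ν.prod γ).real {y | y.1 ≤ x} = ν.real (Iic x) :=
  measurePreserving_fst.measureReal_preimage measurableSet_Iic.nullMeasurableSet

lemma measureReal_prod_lt_abs_snd (ν γ : Measure ℝ) [IsProbabilityMeasure ν] [SFinite γ] (a : ℝ) :
    (ν.prod γ).real {y | a < |y.2|} = γ.real {z | a < |z|} :=
  measurePreserving_snd.measureReal_preimage
    (measurableSet_lt measurable_const measurable_norm).nullMeasurableSet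

lemma measureReal_conv_Iic (ν γ : Measure ℝ) (x : ℝ) :
    (ν ∗ γ).real (Iic x) = (ν.prod γ).real {y | y.1 + y.2 ≤ x} :=
  map_measureReal_apply (by fun_prop) measurableSet_Iic

lemma measureReal_Iic_le_conv (ν γ : Measure ℝ) [IsProbabilityMeasure ν] [IsProbabilityMeasure γ]
    (x a : ℝ) :
    ν.real (Iic x) ≤ (ν ∗ γ).real (Iic (x + a)) + γ.real {y | a < |y|} := by
  simpa only [measureReal_prod_fst_le, measureReal_conv_Iic, sub_add_cancel_left, abs_neg,
    measureReal_prod_lt_abs_snd] using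
    measureReal_le_le_add (μ := ν.prod γ) (V := fun y => y.1) (W := fun y => y.1 + y.2) x a

lemma conv_le_measureReal_Iic (ν γ : Measure ℝ) [IsProbabilityMeasure ν] [IsProbabilityMeasure γ]
    (x a : ℝ) :
    (ν ∗ γ).real (Iic (x - a)) ≤ ν.real (Iic x) + γ.real {y | a < |y|} := by
  simpa only [measureReal_prod_fst_le, measureReal_conv_Iic, add_sub_cancel_left, sub_add_cancel,
    measureReal_prod_lt_abs_snd] using
    measureReal_le_le_add (μ := ν.prod γ) (V := fun y => y.1 + y.2) (W := fun y => y.1) (x - a) a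

lemma abs_measureReal_Iic_sub_gaussianReal_le_of_conv {ν : Measure ℝ} [IsProbabilityMeasure ν]
    {v : ℝ≥0} {a B : ℝ} (ha : 0 < a)
    (hB : ∀ b, |(ν ∗ gaussianReal 0 v).real (Iic b)
      - (gaussianReal 0 1 ∗ gaussianReal 0 v).real (Iic b)| ≤ B) (x : ℝ) :
    |ν.real (Iic x) - (gaussianReal 0 1).real (Iic x)| ≤ B + 2 * (v / a ^ 2) + 2 * a := by
  have htail := gaussianReal_lt_abs_le v ha
  rw [abs_sub_le_iff]
  constructor
  · have hν := measureReal_Iic_le_conv ν (gaussianReal 0 v) x a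
    have hγ := conv_le_measureReal_Iic (gaussianReal 0 1) (gaussianReal 0 v) (x + 2 * a) a
    have hLip := gaussianReal_Iic_add_le x (d := 2 * a) (by positivity)
    rw [show x + 2 * a - a = x + a by ring] at hγ
    linarith [le_of_abs_le (hB (x + a))]
  · have hν := conv_le_measureReal_Iic ν (gaussianReal 0 v) x a
    have hγ := measureReal_Iic_le_conv (gaussianReal 0 1) (gaussianReal 0 v) (x - 2 * a) a
    have hLip := gaussianReal_Iic_add_le (x - 2 * a) (d := 2 * a) (by positivity)
    rw [show x - 2 * a + a = x - a by ring] at hγ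
    rw [sub_add_cancel] at hLip
    linarith [neg_le_of_abs_le (hB (x - a))]

lemma integral_sq_gaussianReal_zero (v : ℝ≥0) : ∫ t, t ^ 2 ∂gaussianReal 0 v = v := by
  have h := variance_eq_sub (memLp_id_gaussianReal (μ := 0) (v := v) 2)
  simp only [variance_id_gaussianReal, id_eq, integral_id_gaussianReal] at h
  simpa using h.symm

end GaussianSmoothing

section EsseenInequality

open Set
open scoped NNReal

lemma abs_conv_gaussianReal_Iic_sub_le_integral_add {ν ρ : Measure ℝ} [IsProbabilityMeasure ν]
    [IsProbabilityMeasure ρ] {v : ℝ≥0} (hv : v ≠ 0) {f : ℝ → ℝ} (hf : Integrable f) (hf0 : 0 ≤ f)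
    {T : ℝ} (hT : 0 < T) (h : ∀ t, |t| ≤ T → 2 * ‖charFun ν t - charFun ρ t‖ ≤ |t| * f t)
    (b : ℝ) :
    |(ν ∗ gaussianReal 0 v).real (Iic b) - (ρ ∗ gaussianReal 0 v).real (Iic b)| ≤
      (∫ t, f t) + 4 / (T ^ 3 * v * √v) := by
  have hfi := integrable_gaussianReal hf 0 (inv_ne_zero hv)
  have hsq : Integrable (fun t : ℝ => 4 / T ^ 3 * t ^ 2) (gaussianReal 0 v⁻¹) :=
    (memLp_id_gaussianReal 2).integrable_sq.const_mul _
  have hle (t : ℝ) : 2 * ‖charFun ν t - charFun ρ t‖ ≤ |t| * (f t + 4 / T ^ 3 * t ^ 2) := by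
    have hft : 0 ≤ f t := hf0 t
    rcases le_or_gt |t| T with ht | ht
    · refine (h t ht).trans ?_
      gcongr
      exact le_add_of_nonneg_right (by positivity)
    · have htwo : ‖charFun ν t - charFun ρ t‖ ≤ 1 + 1 :=
        (norm_sub_le _ _).trans (add_le_add (norm_charFun_le_one t) (norm_charFun_le_one t))
      calc 2 * ‖charFun ν t - charFun ρ t‖ ≤ 4 * 1 := by linarith
        _ ≤ 4 * (|t| ^ 3 / T ^ 3) := by
            gcongr
            exact (one_le_div (by positivity)).2 (by gcongr)
        _ = |t| * (4 / T ^ 3 * t ^ 2) := by rw [← sq_abs t]; ring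
        _ ≤ _ := by gcongr; exact le_add_of_nonneg_left hft
  have hroot : (√(2 * Real.pi * v))⁻¹ ≤ (√v)⁻¹ := by
    have : (0 : ℝ) < v := by positivity
    gcongr
    nlinarith [Real.pi_gt_three]
  calc _ ≤ (√(2 * Real.pi * v))⁻¹ * ∫ t, (f t + 4 / T ^ 3 * t ^ 2) ∂gaussianReal 0 v⁻¹ :=
        abs_conv_gaussianReal_Iic_sub_le hv (hfi.add hsq) hle b
    _ = (√(2 * Real.pi * v))⁻¹ * ∫ t, f t ∂gaussianReal 0 v⁻¹ +
          (√(2 * Real.pi * v))⁻¹ * (4 / T ^ 3 * (v : ℝ)⁻¹) := by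
        rw [integral_add hfi hsq, integral_const_mul, integral_sq_gaussianReal_zero,
          NNReal.coe_inv, mul_add]
    _ ≤ (∫ t, f t) + (√v)⁻¹ * (4 / T ^ 3 * (v : ℝ)⁻¹) := by
        gcongr
        exact integral_gaussianReal_inv_le_integral hf hf0 hv
    _ = _ := by field_simp

/-- Smoothing by a Gaussian of variance `T ^ (-3 / 2)` makes the mass beyond `√T⁻¹`, the shift by
`√T⁻¹` and the frequencies above `T` contribute `O(√T⁻¹)` each. -/
theorem abs_measureReal_Iic_sub_gaussianReal_le {ν : Measure ℝ} [IsProbabilityMeasure ν]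
    {f : ℝ → ℝ} (hf : Integrable f) (hf0 : 0 ≤ f) {T : ℝ} (hT : 0 < T)
    (h : ∀ t, |t| ≤ T → 2 * ‖charFun ν t - charFun (gaussianReal 0 1) t‖ ≤ |t| * f t) (x : ℝ) :
    |ν.real (Iic x) - (gaussianReal 0 1).real (Iic x)| ≤ (∫ t, f t) + 8 / √T := by
  have hI : 0 ≤ ∫ t, f t := integral_nonneg hf0
  obtain ⟨a, ha0, rfl⟩ : ∃ a : ℝ, 0 < a ∧ T = (a ^ 2)⁻¹ :=
    ⟨(√T)⁻¹, by positivity, by rw [inv_pow, Real.sq_sqrt hT.le, inv_inv]⟩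
  rw [Real.sqrt_inv, Real.sqrt_sq ha0.le, div_inv_eq_mul]
  rcases le_or_gt 1 a with ha1 | ha1
  · have : |ν.real (Iic x) - (gaussianReal 0 1).real (Iic x)| ≤ 1 - 0 :=
      abs_sub_le_of_le_of_le measureReal_nonneg measureReal_le_one measureReal_nonneg
        measureReal_le_one
    linarith
  have hva : (0 : ℝ) < a ^ 3 := by positivity
  have hsmooth := abs_conv_gaussianReal_Iic_sub_le_integral_add (v := ⟨a ^ 3, hva.le⟩)
    (ne_of_gt hva) hf hf0 hT h
  have htail : |ν.real (Iic x) - (gaussianReal 0 1).real (Iic x)| ≤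
      (∫ t, f t) + 4 / ((a ^ 2)⁻¹ ^ 3 * a ^ 3 * √(a ^ 3)) + 2 * (a ^ 3 / a ^ 2) + 2 * a :=
    abs_measureReal_Iic_sub_gaussianReal_le_of_conv ha0 hsmooth x
  have hroot : a ^ 2 ≤ √(a ^ 3) :=
    Real.le_sqrt_of_sq_le (by nlinarith)
  have hfreq : 4 / ((a ^ 2)⁻¹ ^ 3 * a ^ 3 * √(a ^ 3)) ≤ 4 * a :=
    calc 4 / ((a ^ 2)⁻¹ ^ 3 * a ^ 3 * √(a ^ 3)) ≤ 4 / ((a ^ 2)⁻¹ ^ 3 * a ^ 3 * a ^ 2) := by gcongr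
      _ = 4 * a := by field_simp
  rw [show a ^ 3 / a ^ 2 = a by field_simp] at htail
  linarith

end EsseenInequality

section CharFunRate

open Complex

lemma norm_exp_mul_I_sub_taylor_two_le {δ : ℝ} (hδ0 : 0 ≤ δ) (hδ : δ ≤ 1) (y : ℝ) :
    ‖cexp (y * I) - (1 + y * I - y ^ 2 / 2)‖ ≤ 4 * |y| ^ (2 + δ) := by
  have hyI : ‖(y * I : ℂ)‖ = |y| := by simp
  rcases le_or_gt |y| 1 with hy | hy
  · have htaylor := Complex.exp_bound (x := y * I) (hyI.trans_le hy) (n := 3) (by norm_num)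
    have hsum : ∑ m ∈ Finset.range 3, (y * I : ℂ) ^ m / (m.factorial : ℂ)
        = 1 + y * I - y ^ 2 / 2 := by
      simp only [Finset.sum_range_succ, Finset.sum_range_zero, Nat.factorial]
      push_cast
      linear_combination (y ^ 2 / 2 : ℂ) * I_sq
    have hcube : |y| ^ 3 ≤ |y| ^ (2 + δ) := by
      rw [← Real.rpow_natCast]
      exact Real.rpow_le_rpow_of_exponent_ge_of_imp (abs_nonneg y) hy
        (by norm_num; linarith) fun _ h => absurd h (by norm_num)
    rw [hsum, hyI] at htaylor
    refine htaylor.trans ?_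
    norm_num [Nat.factorial]
    linarith [pow_nonneg (abs_nonneg y) 3]
  · have hsq : y ^ 2 ≤ |y| ^ (2 + δ) := by
      rw [← sq_abs, ← Real.rpow_natCast]
      exact Real.rpow_le_rpow_of_exponent_le hy.le (by norm_num; linarith)
    have hone : |y| ≤ y ^ 2 := by rw [← sq_abs]; nlinarith
    have hpoly : ‖(1 + y * I - y ^ 2 / 2 : ℂ)‖ ≤ 1 + |y| + y ^ 2 / 2 := by
      refine (norm_sub_le _ _).trans (add_le_add ((norm_add_le _ _).trans ?_) ?_) <;> simp
    refine (norm_sub_le _ _).trans ?_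
    rw [norm_exp_ofReal_mul_I]
    linarith

lemma norm_pow_sub_pow_le_mul {R : Type*} [NormedCommRing R] [NormOneClass R] {a b : R} {M : ℝ}
    (ha : ‖a‖ ≤ M) (hb : ‖b‖ ≤ M) (n : ℕ) :
    ‖a ^ n - b ^ n‖ ≤ n * ‖a - b‖ * M ^ (n - 1) := by
  have hM : 0 ≤ M := (norm_nonneg _).trans ha
  have hterm (i : ℕ) (hi : i ∈ Finset.range n) : ‖a ^ i * b ^ (n - 1 - i)‖ ≤ M ^ (n - 1) :=
    calc ‖a ^ i * b ^ (n - 1 - i)‖ ≤ ‖a‖ ^ i * ‖b‖ ^ (n - 1 - i) :=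
          norm_mul_le_of_le (norm_pow_le _ _) (norm_pow_le _ _)
      _ ≤ M ^ i * M ^ (n - 1 - i) := by gcongr
      _ = M ^ (n - 1) := by
          rw [← pow_add, Nat.add_sub_cancel' (Nat.le_sub_one_of_lt (Finset.mem_range.1 hi))]
  rw [← (Commute.all a b).mul_geom_sum₂]
  calc _ ≤ ‖a - b‖ * ‖∑ i ∈ Finset.range n, a ^ i * b ^ (n - 1 - i)‖ := norm_mul_le _ _
    _ ≤ ‖a - b‖ * (n * M ^ (n - 1)) := by
        gcongr
        simpa using norm_sum_le_of_le (Finset.range n) hterm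
    _ = _ := by ring

lemma charFun_gaussianReal_zero_one (t : ℝ) :
    charFun (gaussianReal 0 1) t = (Real.exp (-t ^ 2 / 2) : ℂ) := by
  rw [charFun_gaussianReal]
  push_cast
  congr 1
  ring

lemma norm_exp_neg_sq_div_two_sub_le {δ s : ℝ} (hδ : δ ≤ 1) (hs : |s| ≤ 1) :
    ‖(1 - s ^ 2 / 2 : ℂ) - Real.exp (-s ^ 2 / 2)‖ ≤ |s| ^ (2 + δ) := by
  have hs2 : s ^ 2 ≤ 1 := (sq_le_one_iff_abs_le_one s).2 hs
  have hexp := Real.norm_exp_sub_one_sub_id_le (x := -s ^ 2 / 2) (by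
    rw [Real.norm_eq_abs, abs_of_nonpos (by linarith [sq_nonneg s])]; linarith)
  have hpow : |s| ^ 4 ≤ |s| ^ (2 + δ) := by
    rw [← Real.rpow_natCast]
    exact Real.rpow_le_rpow_of_exponent_ge_of_imp (abs_nonneg s) hs (by norm_num; linarith)
      fun _ h => absurd h (by norm_num)
  rw [norm_sub_rev, show (Real.exp (-s ^ 2 / 2) : ℂ) - (1 - s ^ 2 / 2) =
    ((Real.exp (-s ^ 2 / 2) - 1 - -s ^ 2 / 2 : ℝ) : ℂ) by push_cast; ring, Complex.norm_real]
  refine hexp.trans (le_trans ?_ hpow)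
  rw [Real.norm_eq_abs, sq_abs, show |s| ^ 4 = s ^ 4 from Even.pow_abs (by decide) s]
  linarith [show 0 ≤ s ^ 4 by positivity, show (-s ^ 2 / 2) ^ 2 = s ^ 4 / 4 by ring]

variable {ν : Measure ℝ} [IsProbabilityMeasure ν] {δ : ℝ}

lemma norm_charFun_sub_taylor_two_le (hδ0 : 0 ≤ δ) (hδ : δ ≤ 1)
    (hLp : MemLp id (ENNReal.ofReal (2 + δ)) ν) (hmean : ∫ x, x ∂ν = 0)
    (hvar : ∫ x, x ^ 2 ∂ν = 1) (s : ℝ) :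
    ‖charFun ν s - (1 - s ^ 2 / 2)‖ ≤ 4 * (∫ x, |x| ^ (2 + δ) ∂ν) * |s| ^ (2 + δ) := by
  have hL2 : MemLp id 2 ν := hLp.mono_exponent (by
    rw [← ENNReal.ofReal_ofNat]; exact ENNReal.ofReal_le_ofReal (by linarith))
  have hmom : Integrable (fun x : ℝ => |x| ^ (2 + δ)) ν := by
    have := hLp.integrable_norm_rpow (by simp; linarith) ENNReal.ofReal_ne_top
    rwa [ENNReal.toReal_ofReal (by linarith)] at this
  have hlin : Integrable (fun x : ℝ => ((s * x : ℝ) : ℂ) * I) ν :=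
    ((hL2.integrable one_le_two).const_mul s).ofReal.mul_const I
  have haffine : Integrable (fun x : ℝ => 1 + ((s * x : ℝ) : ℂ) * I) ν :=
    (integrable_const 1).add hlin
  have hquad : Integrable (fun x : ℝ => ((s ^ 2 * x ^ 2 / 2 : ℝ) : ℂ)) ν :=
    ((hL2.integrable_sq.const_mul _).div_const _).ofReal
  have hpoly : Integrable (fun x : ℝ => 1 + ((s * x : ℝ) : ℂ) * I - (s ^ 2 * x ^ 2 / 2 : ℝ)) ν :=
    haffine.sub hquad
  have hexp : Integrable (fun x : ℝ => cexp ((s * x : ℝ) * I)) ν :=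
    Integrable.of_bound (C := 1) (by fun_prop) (ae_of_all _ fun x => (norm_exp_ofReal_mul_I _).le)
  have hpoly_int :
      ∫ x, (1 + ((s * x : ℝ) : ℂ) * I - (s ^ 2 * x ^ 2 / 2 : ℝ)) ∂ν = 1 - s ^ 2 / 2 := by
    rw [integral_sub haffine hquad, integral_add (integrable_const 1) hlin,
      integral_mul_const, integral_complex_ofReal, integral_complex_ofReal, integral_const_mul,
      hmean, integral_div, integral_const_mul, hvar]
    simp
  have hsub : charFun ν s - (1 - s ^ 2 / 2) =
      ∫ x, (cexp ((s * x : ℝ) * I) - (1 + ((s * x : ℝ) : ℂ) * I - (s ^ 2 * x ^ 2 / 2 : ℝ))) ∂ν := by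
    rw [integral_sub hexp hpoly, hpoly_int, charFun_apply_real]
    push_cast
    rfl
  rw [hsub]
  refine (norm_integral_le_of_norm_le (hmom.const_mul (4 * |s| ^ (2 + δ)))
    (ae_of_all _ fun x => ?_)).trans_eq (by rw [integral_const_mul]; ring)
  rw [mul_assoc, ← Real.mul_rpow (abs_nonneg _) (abs_nonneg _), ← abs_mul]
  simpa [mul_pow] using norm_exp_mul_I_sub_taylor_two_le hδ0 hδ (s * x)

lemma norm_charFun_sub_exp_le (hδ0 : 0 ≤ δ) (hδ : δ ≤ 1)
    (hLp : MemLp id (ENNReal.ofReal (2 + δ)) ν) (hmean : ∫ x, x ∂ν = 0)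
    (hvar : ∫ x, x ^ 2 ∂ν = 1) {s : ℝ} (hs : |s| ≤ 1) :
    ‖charFun ν s - Real.exp (-s ^ 2 / 2)‖ ≤ (4 * (∫ x, |x| ^ (2 + δ) ∂ν) + 1) * |s| ^ (2 + δ) := by
  refine (norm_sub_le_norm_sub_add_norm_sub _ (1 - s ^ 2 / 2 : ℂ) _).trans ?_
  rw [add_mul, one_mul]
  exact add_le_add (norm_charFun_sub_taylor_two_le hδ0 hδ hLp hmean hvar s)
    (norm_exp_neg_sq_div_two_sub_le hδ hs)

lemma exists_norm_charFun_le_exp (hmean : ∫ x, x ∂ν = 0) (hvar : ∫ x, x ^ 2 ∂ν = 1) :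
    ∃ c : ℝ, 0 < c ∧ ∀ s : ℝ, |s| ≤ c → ‖charFun ν s‖ ≤ Real.exp (-s ^ 2 / 4) := by
  have htaylor := taylor_charFun_two (P := ν) aemeasurable_id hmean hvar
  rw [Measure.map_id] at htaylor
  obtain ⟨c, hc, hball⟩ :=
    Metric.eventually_nhds_iff.1 (htaylor.bound (by norm_num : (0 : ℝ) < 1 / 4))
  refine ⟨min (c / 2) 1, by positivity, fun s hs => ?_⟩
  have hs1 : s ^ 2 ≤ 1 := (sq_le_one_iff_abs_le_one s).2 (hs.trans (min_le_right _ _))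
  have hrem : ‖charFun ν s - (1 - s ^ 2 / 2)‖ ≤ 1 / 4 * s ^ 2 := by
    have := hball (y := s) (by
      rw [Real.dist_eq, sub_zero]; exact (hs.trans (min_le_left _ _)).trans_lt (by linarith))
    simpa using this
  have hmain : ‖(1 - s ^ 2 / 2 : ℂ)‖ = 1 - s ^ 2 / 2 := by
    rw [show (1 - s ^ 2 / 2 : ℂ) = ((1 - s ^ 2 / 2 : ℝ) : ℂ) by push_cast; rfl, Complex.norm_real,
      Real.norm_of_nonneg (by linarith)]
  calc ‖charFun ν s‖ ≤ ‖(1 - s ^ 2 / 2 : ℂ)‖ + ‖charFun ν s - (1 - s ^ 2 / 2)‖ :=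
        norm_le_norm_add_norm_sub' _ _
    _ ≤ -s ^ 2 / 4 + 1 := by linarith
    _ ≤ Real.exp (-s ^ 2 / 4) := Real.add_one_le_exp _

lemma mul_abs_inv_sqrt_mul_rpow {a : ℝ} (ha : 0 < a) (t δ : ℝ) :
    a * |(√a)⁻¹ * t| ^ (2 + δ) = a ^ (-δ / 2) * |t| ^ (2 + δ) := by
  rw [abs_mul, abs_of_pos (by positivity : 0 < (√a)⁻¹), Real.mul_rpow (by positivity)
    (abs_nonneg _), ← mul_assoc, Real.sqrt_eq_rpow, ← Real.rpow_neg ha.le, ← Real.rpow_mul ha.le]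
  nth_rw 1 [← Real.rpow_one a]
  rw [← Real.rpow_add ha]
  congr 2
  ring

lemma exists_norm_charFun_pow_sub_le (hδ0 : 0 ≤ δ) (hδ : δ ≤ 1)
    (hLp : MemLp id (ENNReal.ofReal (2 + δ)) ν) (hmean : ∫ x, x ∂ν = 0)
    (hvar : ∫ x, x ^ 2 ∂ν = 1) :
    ∃ A c : ℝ, 0 ≤ A ∧ 0 < c ∧ ∀ n : ℕ, n ≠ 0 → ∀ t : ℝ, |t| ≤ c * √n →
      ‖charFun ν ((√n)⁻¹ * t) ^ n - charFun (gaussianReal 0 1) t‖ ≤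
        A * (n : ℝ) ^ (-δ / 2) * (|t| ^ (2 + δ) * Real.exp (-(1 / 4) * t ^ 2)) := by
  obtain ⟨c, hc, hφ⟩ := exists_norm_charFun_le_exp hmean hvar
  set β := ∫ x, |x| ^ (2 + δ) ∂ν
  have : 0 ≤ β := integral_nonneg fun x => by positivity
  refine ⟨(4 * β + 1) * Real.exp (1 / 4), min c 1, by positivity, by positivity,
    fun n hn t ht => ?_⟩
  have hn0 : (0 : ℝ) < n := by positivity
  set s := (√(n : ℝ))⁻¹ * t with hs
  have hsc : |s| ≤ min c 1 := by
    rw [hs, abs_mul, abs_of_pos (by positivity), inv_mul_le_iff₀ (by positivity)]; linarith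
  have hs1 : |s| ≤ 1 := hsc.trans (min_le_right _ _)
  have hs2 : s ^ 2 ≤ 1 := (sq_le_one_iff_abs_le_one s).2 hs1
  have hdiff := norm_charFun_sub_exp_le hδ0 hδ hLp hmean hvar hs1
  have hns : n * s ^ 2 = t ^ 2 := by
    rw [hs, mul_pow, inv_pow, Real.sq_sqrt hn0.le, mul_inv_cancel_left₀ hn0.ne']
  have hψ : ‖(Real.exp (-s ^ 2 / 2) : ℂ)‖ ≤ Real.exp (-s ^ 2 / 4) := by
    rw [Complex.norm_real, Real.norm_of_nonneg (Real.exp_pos _).le, Real.exp_le_exp]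
    linarith [sq_nonneg s]
  have hgauss : (Real.exp (-s ^ 2 / 2) : ℂ) ^ n = charFun (gaussianReal 0 1) t := by
    rw [charFun_gaussianReal_zero_one, ← ofReal_pow, ← Real.exp_nat_mul, ← hns]
    congr 2
    ring
  have hexp : Real.exp (-s ^ 2 / 4) ^ (n - 1) ≤
      Real.exp (1 / 4) * Real.exp (-(1 / 4) * t ^ 2) := by
    rw [← Real.exp_nat_mul, ← Real.exp_add, Real.exp_le_exp,
      Nat.cast_pred (Nat.pos_of_ne_zero hn), ← hns]
    linarith
  rw [← hgauss]
  calc _ ≤ n * ‖charFun ν s - Real.exp (-s ^ 2 / 2)‖ * Real.exp (-s ^ 2 / 4) ^ (n - 1) :=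
        norm_pow_sub_pow_le_mul (hφ s (hsc.trans (min_le_left _ _))) hψ n
    _ ≤ n * ((4 * β + 1) * |s| ^ (2 + δ)) *
          (Real.exp (1 / 4) * Real.exp (-(1 / 4) * t ^ 2)) := by gcongr
    _ = (4 * β + 1) * Real.exp (1 / 4) * (n * |s| ^ (2 + δ)) *
          Real.exp (-(1 / 4) * t ^ 2) := by ring
    _ = _ := by rw [mul_abs_inv_sqrt_mul_rpow hn0]; ring

end CharFunRate

section BerryEsseen

open Set

lemma integrable_abs_rpow_mul_exp_neg_mul_sq {b s : ℝ} (hb : 0 < b) (hs : -1 < s) :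
    Integrable fun t : ℝ => |t| ^ s * Real.exp (-b * t ^ 2) := by
  have h := (integrable_fun_norm_addHaar (E := ℝ) volume
    (f := fun t : ℝ => t ^ s * Real.exp (-b * t ^ 2))).2
    (by simpa using integrableOn_rpow_mul_exp_neg_mul_sq hb hs)
  simpa only [Real.norm_eq_abs, sq_abs] using h

lemma inv_sqrt_mul_sqrt {a b : ℝ} (ha : 0 ≤ a) (hb : 0 ≤ b) :
    (√(a * √b))⁻¹ = (√a)⁻¹ * b ^ (-(1 / 4) : ℝ) := by
  rw [Real.sqrt_mul ha, mul_inv, Real.rpow_neg hb, Real.sqrt_eq_rpow √b, Real.sqrt_eq_rpow b,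
    ← Real.rpow_mul hb]
  norm_num

theorem exists_abs_measureReal_Iic_sub_le_of_charFun_eq_pow {ν : Measure ℝ}
    [IsProbabilityMeasure ν] {δ : ℝ} (hδ0 : 0 ≤ δ) (hδ : δ ≤ 1 / 2)
    (hLp : MemLp id (ENNReal.ofReal (2 + δ)) ν) (hmean : ∫ x, x ∂ν = 0)
    (hvar : ∫ x, x ^ 2 ∂ν = 1) :
    ∃ C : ℝ, ∀ n : ℕ, n ≠ 0 → ∀ (ρ : Measure ℝ) [IsProbabilityMeasure ρ],
      (∀ t, charFun ρ t = charFun ν ((√n)⁻¹ * t) ^ n) → ∀ x,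
      |ρ.real (Iic x) - (gaussianReal 0 1).real (Iic x)| ≤ C * (n : ℝ) ^ (-δ / 2) := by
  obtain ⟨A, c, hA, hc, hrate⟩ :=
    exists_norm_charFun_pow_sub_le hδ0 (by linarith) hLp hmean hvar
  set M := ∫ t : ℝ, |t| ^ (1 + δ) * Real.exp (-(1 / 4) * t ^ 2)
  refine ⟨2 * A * M + 8 / √c, fun n hn ρ _ hρ x => ?_⟩
  have hn0 : (0 : ℝ) < n := by positivity
  have hn1 : (1 : ℝ) ≤ n := Nat.one_le_cast.2 (Nat.one_le_iff_ne_zero.2 hn)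
  have hclose (t : ℝ) (ht : |t| ≤ c * √n) :
      2 * ‖charFun ρ t - charFun (gaussianReal 0 1) t‖ ≤ |t| *
        (2 * A * (n : ℝ) ^ (-δ / 2) * (|t| ^ (1 + δ) * Real.exp (-(1 / 4) * t ^ 2))) := by
    have hpow : |t| ^ (2 + δ) = |t| * |t| ^ (1 + δ) := by
      rw [← Real.rpow_one_add' (abs_nonneg t) (by linarith)]
      congr 1
      ring
    have h := hrate n hn t ht
    rw [← hρ, hpow] at h
    linarith
  have hEsseen := abs_measureReal_Iic_sub_gaussianReal_le
    ((integrable_abs_rpow_mul_exp_neg_mul_sq (by norm_num : (0 : ℝ) < 1 / 4)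
      (by linarith : -1 < 1 + δ)).const_mul (2 * A * (n : ℝ) ^ (-δ / 2)))
    (fun t => by positivity) (by positivity) hclose x
  rw [integral_const_mul] at hEsseen
  have htail : 8 / √(c * √(n : ℝ)) ≤ 8 / √c * (n : ℝ) ^ (-δ / 2) :=
    calc 8 / √(c * √(n : ℝ)) = 8 / √c * (n : ℝ) ^ (-(1 / 4) : ℝ) := by
          rw [div_eq_mul_inv, inv_sqrt_mul_sqrt hc.le hn0.le]
          ring
      _ ≤ 8 / √c * (n : ℝ) ^ (-δ / 2) := by
          gcongr
          linarith
  linarith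

end BerryEsseen

section SumsOfIIDVariables

open Set

variable {Ω : Type*} [MeasurableSpace Ω] {μ : Measure Ω} [IsProbabilityMeasure μ]

theorem exists_abs_measureReal_inv_sqrt_mul_sum_sub_cdf_le {ξ : ℕ → Ω → ℝ} {δ : ℝ}
    (hindep : iIndepFun ξ μ) (hident : ∀ k, IdentDistrib (ξ k) (ξ 0) μ μ) (hδ0 : 0 ≤ δ)
    (hδ : δ ≤ 1 / 2) (hLp : MemLp (ξ 0) (ENNReal.ofReal (2 + δ)) μ) (hmean : μ[ξ 0] = 0)
    (hvar : μ[ξ 0 ^ 2] = 1) :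
    ∃ C : ℝ, ∀ n : ℕ, n ≠ 0 → ∀ x : ℝ,
      |μ.real {ω | (√n)⁻¹ * ∑ k ∈ Finset.range n, ξ k ω ≤ x} - cdf (gaussianReal 0 1) x|
        ≤ C * (n : ℝ) ^ (-δ / 2) := by
  have hξ (k : ℕ) : AEMeasurable (ξ k) μ := (hident k).aemeasurable_fst
  have := Measure.isProbabilityMeasure_map (hξ 0)
  obtain ⟨C, hC⟩ := exists_abs_measureReal_Iic_sub_le_of_charFun_eq_pow (ν := μ.map (ξ 0)) hδ0 hδ
    ((memLp_map_measure_iff aestronglyMeasurable_id (hξ 0)).2 hLp)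
    ((integral_map (hξ 0) aestronglyMeasurable_id).trans hmean)
    ((integral_map (hξ 0) (by fun_prop)).trans hvar)
  refine ⟨C, fun n hn x => ?_⟩
  have hsum : AEMeasurable (fun ω => (√n)⁻¹ * ∑ k ∈ Finset.range n, ξ k ω) μ :=
    (Finset.aemeasurable_fun_sum _ fun k _ => hξ k).const_mul _
  have := Measure.isProbabilityMeasure_map hsum
  have h := hC n hn _ (fun t => charFun_inv_sqrt_mul_sum hindep hident) x
  rwa [map_measureReal_apply_of_aemeasurable hsum measurableSet_Iic, ← cdf_eq_real] at h

theorem berry_esseen {ξ : ℕ → Ω → ℝ} {δ : ℝ}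
    (hindep : iIndepFun ξ μ) (hident : ∀ k, IdentDistrib (ξ k) (ξ 0) μ μ) (hδ0 : 0 ≤ δ)
    (hδ : δ ≤ 1 / 2) (hLp : MemLp (ξ 0) (ENNReal.ofReal (2 + δ)) μ) (hvar : Var[ξ 0; μ] ≠ 0) :
    ∃ C : ℝ, ∀ n : ℕ, n ≠ 0 → ∀ x : ℝ,
      |μ.real {ω | √n / √Var[ξ 0; μ] * ((∑ k ∈ Finset.range n, ξ k ω) / n - μ[ξ 0]) ≤ x} -
        cdf (gaussianReal 0 1) x| ≤ C * (n : ℝ) ^ (-δ / 2) := by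
  set σ := √Var[ξ 0; μ] with hσ
  have hσ0 : σ ≠ 0 := (Real.sqrt_ne_zero (variance_nonneg _ _)).2 hvar
  set m := μ[ξ 0] with hm
  let standardize (y : ℝ) : ℝ := (y - m) / σ
  have hstd : Measurable standardize := by fun_prop
  have hLp' : MemLp (standardize ∘ ξ 0) (ENNReal.ofReal (2 + δ)) μ := by
    simpa [Function.comp_def, standardize, div_eq_inv_mul] using
      (hLp.sub (memLp_const m)).const_mul σ⁻¹
  have hmean : μ[standardize ∘ ξ 0] = 0 := by
    have : Integrable (ξ 0) μ := hLp.integrable (by simp; linarith)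
    simp only [Function.comp_def, standardize]
    rw [integral_div, integral_sub this (integrable_const m), integral_const]
    simp [hm]
  have hvar' : μ[(standardize ∘ ξ 0) ^ 2] = 1 := by
    simp only [Function.comp_def, standardize, Pi.pow_apply, div_pow]
    rw [integral_div, ← variance_eq_integral hLp.aemeasurable, hσ,
      Real.sq_sqrt (variance_nonneg _ _), div_self hvar]
  obtain ⟨C, hC⟩ := exists_abs_measureReal_inv_sqrt_mul_sum_sub_cdf_le
    (hindep.comp (fun _ => standardize) fun _ => hstd) (fun k => (hident k).comp hstd)
    hδ0 hδ hLp' hmean hvar'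
  refine ⟨C, fun n hn x => ?_⟩
  have hn0 : (n : ℝ) ≠ 0 := Nat.cast_ne_zero.2 hn
  have hstat (ω : Ω) : √n / σ * ((∑ k ∈ Finset.range n, ξ k ω) / n - m) =
      (√n)⁻¹ * ∑ k ∈ Finset.range n, (standardize ∘ ξ k) ω := by
    simp only [Function.comp_apply, standardize]
    rw [← Finset.sum_div, Finset.sum_sub_distrib, Finset.sum_const, Finset.card_range,
      nsmul_eq_mul]
    field_simp
    rw [Real.sq_sqrt n.cast_nonneg]
  simpa only [hstat] using hC n hn x

end SumsOfIIDVariables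

section Perturbation

variable {Ω : Type*} [MeasurableSpace Ω] {μ : Measure Ω} [IsProbabilityMeasure μ]

lemma abs_measureReal_le_sub_cdf_le_of_perturbation {S W : Ω → ℝ} {B τ η : ℝ} (hη : 0 ≤ η)
    (hS : ∀ x, |μ.real {ω | S ω ≤ x} - cdf (gaussianReal 0 1) x| ≤ B)
    (hWS : μ.real {ω | η < |W ω - S ω|} ≤ τ) (x : ℝ) :
    |μ.real {ω | W ω ≤ x} - cdf (gaussianReal 0 1) x| ≤ B + τ + η := by
  have hΦ (y : ℝ) : cdf (gaussianReal 0 1) (y + η) ≤ cdf (gaussianReal 0 1) y + η := by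
    simpa only [cdf_eq_real] using gaussianReal_Iic_add_le y hη
  have hSW : μ.real {ω | η < |S ω - W ω|} ≤ τ := by simpa only [abs_sub_comm] using hWS
  have hupper := measureReal_le_le_add (μ := μ) (V := W) (W := S) x η
  have hlower := measureReal_le_le_add (μ := μ) (V := S) (W := W) (x - η) η
  have hΦx := hΦ (x - η)
  rw [sub_add_cancel] at hlower hΦx
  rw [abs_sub_le_iff]
  constructor
  · linarith [le_of_abs_le (hS (x + η)), hΦ x]
  · linarith [neg_le_of_abs_le (hS (x - η))]

lemma measureReal_lt_le_integral_div {Z U : Ω → ℝ} (hZ : 0 ≤ᵐ[μ] Z) (hZU : Z ≤ᵐ[μ] U)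
    (hU : Integrable U μ) {η : ℝ} (hη : 0 < η) :
    μ.real {ω | η < Z ω} ≤ (∫ ω, U ω ∂μ) / η := by
  have hsub : {ω | η < Z ω} ≤ᵐ[μ] {ω | η ≤ U ω} := by
    filter_upwards [hZU] with ω hω (h : η < Z ω) using h.le.trans hω
  rw [le_div_iff₀' hη]
  calc η * μ.real {ω | η < Z ω} ≤ η * μ.real {ω | η ≤ U ω} :=
        mul_le_mul_of_nonneg_left
          (ENNReal.toReal_mono (measure_ne_top _ _) (measure_mono_ae hsub)) hη.le
    _ ≤ ∫ ω, U ω ∂μ := mul_meas_ge_le_integral_of_nonneg (hZ.trans hZU) hU η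

end Perturbation

section RealInequalities

open Finset

lemma sub_le_mul_log_sub_mul_log {r m : ℝ} (hr : 0 ≤ r) (hm : 0 < m) :
    r - m ≤ r * Real.log r - r * Real.log m := by
  rcases hr.eq_or_lt with rfl | hr
  · simp [hm.le]
  calc r - m = r * (1 - (r / m)⁻¹) := by field_simp
    _ ≤ r * Real.log (r / m) := by
        gcongr
        exact Real.one_sub_inv_le_log_of_pos (by positivity)
    _ = _ := by rw [Real.log_div hr.ne' hm.ne', mul_sub]

lemma mul_log_sub_mul_log_le {r m : ℝ} (hr : 0 ≤ r) (hm : 0 < m) :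
    r * Real.log r - r * Real.log m ≤ r ^ 2 / m - r := by
  rcases hr.eq_or_lt with rfl | hr
  · simp
  calc r * Real.log r - r * Real.log m = r * Real.log (r / m) := by
        rw [Real.log_div hr.ne' hm.ne', mul_sub]
    _ ≤ r * (r / m - 1) := by
        gcongr
        exact Real.log_le_sub_one_of_pos (by positivity)
    _ = r ^ 2 / m - r := by ring

lemma sum_mul_log_sub_card_mul_mem_Icc {ι : Type*} {s : Finset ι} {w : ι → ℝ} {m : ℝ}
    (hw : ∀ j ∈ s, 0 ≤ w j) (hm : 0 < m) (hsum : ∑ j ∈ s, w j = #s * m) :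
    ∑ j ∈ s, w j * Real.log (w j) - #s * (m * Real.log m) ∈
      Set.Icc 0 ((∑ j ∈ s, w j ^ 2) / m - #s * m) := by
  have hlower := sum_le_sum fun j hj => sub_le_mul_log_sub_mul_log (hw j hj) hm
  have hupper := sum_le_sum fun j hj => mul_log_sub_mul_log_le (hw j hj) hm
  simp only [sum_sub_distrib, ← sum_mul, ← sum_div, hsum, sum_const, nsmul_eq_mul] at hlower hupper
  constructor <;> linarith

lemma log_one_add_le_rpow_div {u ε : ℝ} (hu : 0 ≤ u) (hε0 : 0 < ε) (hε : ε ≤ 1) :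
    Real.log (1 + u) ≤ u ^ ε / ε := by
  rw [le_div_iff₀' hε0, ← Real.log_rpow (by positivity)]
  calc Real.log ((1 + u) ^ ε) ≤ (1 + u) ^ ε - 1 := Real.log_le_sub_one_of_pos (by positivity)
    _ ≤ u ^ ε := by
        have := Real.rpow_add_le_add_rpow zero_le_one hu hε0.le hε
        rw [Real.one_rpow] at this
        linarith

lemma neg_log_le_neg_log_add {p q a ε : ℝ} (hp : 0 < p) (hq : 0 < q) (ha : 0 < a) (hε0 : 0 < ε)
    (hε : ε ≤ 1) :
    -Real.log p ≤ -Real.log q + (a ^ ε / ε * p ^ (-ε) + (q / (p + a) - 1)) := by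
  have hlog : Real.log q = Real.log p + Real.log (1 + a / p) + Real.log (q / (p + a)) := by
    rw [← Real.log_mul (by positivity) (by positivity),
      ← Real.log_mul (by positivity) (by positivity)]
    congr 1
    field_simp
  have hratio := Real.log_le_sub_one_of_pos (show 0 < q / (p + a) by positivity)
  have hshift : Real.log (1 + a / p) ≤ a ^ ε / ε * p ^ (-ε) := by
    refine (log_one_add_le_rpow_div (by positivity) hε0 hε).trans_eq ?_
    rw [Real.div_rpow ha.le hp.le, Real.rpow_neg hp.le]
    ring
  linarith

lemma le_rpow_mul_add {p q a ε : ℝ} (hp : 0 < p) (ha : 0 < a) (hq : a ≤ q) (hε0 : 0 ≤ ε)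
    (hε : ε ≤ 1) : a ≤ a ^ ε * (p ^ (1 - ε) + q * p ^ (-ε)) := by
  have hq0 : 0 < q := ha.trans_le hq
  rcases le_total a p with hap | hpa
  · calc a = a ^ ε * a ^ (1 - ε) := by rw [← Real.rpow_add ha]; simp
      _ ≤ a ^ ε * p ^ (1 - ε) := by gcongr
      _ ≤ _ := by gcongr; exact le_add_of_nonneg_right (by positivity)
  · calc a = a ^ ε * (a * a ^ (-ε)) := by rw [Real.rpow_neg ha.le]; field_simp
      _ ≤ a ^ ε * (q * p ^ (-ε)) := by
          gcongr a ^ ε * (?_ * ?_)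
          exact Real.rpow_le_rpow_of_nonpos hp hpa (by linarith)
      _ ≤ _ := by gcongr; exact le_add_of_nonneg_left (by positivity)

lemma abs_log_rpow_le {p r ε : ℝ} (hp0 : 0 ≤ p) (hp : p ≤ 1) (hr : 0 < r) (hε : 0 < ε) :
    |Real.log p| ^ r ≤ (r / ε) ^ r * p ^ (-ε) := by
  rcases hp0.eq_or_lt with rfl | hp0
  · rw [Real.log_zero, abs_zero, Real.zero_rpow hr.ne']
    positivity
  have hlog : |Real.log p| ≤ r / ε * p ^ (-(ε / r)) := by
    have h := (Real.abs_log_mul_self_rpow_lt p (ε / r) hp0 hp (by positivity)).le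
    rwa [abs_mul, abs_of_pos (Real.rpow_pos_of_pos hp0 _), ← le_div_iff₀ (by positivity),
      one_div_div, div_eq_mul_inv (r / ε), ← Real.rpow_neg hp0.le] at h
  calc |Real.log p| ^ r ≤ (r / ε * p ^ (-(ε / r))) ^ r := by gcongr
    _ = (r / ε) ^ r * p ^ (-ε) := by
        rw [Real.mul_rpow (by positivity) (by positivity), ← Real.rpow_mul hp0.le]
        congr 2
        field_simp

end RealInequalities

section SampleMean

open Finset

/-- The mean of `f` over the first `n` observations `x 0, …, x (n - 1)`, that is, the expectation
of `f` under the empirical distribution. -/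
noncomputable def sampleMean {α : Type*} (n : ℕ) (x : ℕ → α) (f : α → ℝ) : ℝ :=
  (∑ k ∈ range n, f (x k)) / n

/-- The letters observed among `x 0, …, x (n - 1)`: the support of the sample proportions. -/
def observedLetters (n : ℕ) (x : ℕ → ℕ+) : Finset ℕ+ := (range n).image x

variable {n : ℕ} {x : ℕ → ℕ+}

lemma mem_observedLetters {k : ℕ} (hk : k ∈ range n) : x k ∈ observedLetters n x :=
  mem_image_of_mem x hk

lemma letterInd_nonneg (y i : ℕ+) : 0 ≤ letterInd y i := by
  unfold letterInd
  positivity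

lemma letterInd_eq_zero {k : ℕ} (hk : k ∈ range n) {i : ℕ+} (hi : i ∉ observedLetters n x) :
    letterInd (x k) i = 0 :=
  if_neg fun h : x k = i => hi (h ▸ mem_observedLetters hk)

lemma sampleProp_nonneg (i : ℕ+) : 0 ≤ sampleProp n x i :=
  mul_nonneg (by positivity) (sum_nonneg fun _ _ => letterInd_nonneg _ _)

lemma sampleProp_eq_zero {i : ℕ+} (hi : i ∉ observedLetters n x) : sampleProp n x i = 0 := by
  rw [sampleProp, sum_eq_zero fun k hk => letterInd_eq_zero hk hi, mul_zero]

lemma inv_le_sampleProp {i : ℕ+} (hi : i ∈ observedLetters n x) :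
    (n : ℝ)⁻¹ ≤ sampleProp n x i := by
  obtain ⟨k, hk, rfl⟩ := mem_image.1 hi
  have hone : 1 ≤ ∑ j ∈ range n, letterInd (x j) (x k) :=
    calc (1 : ℝ) = letterInd (x k) (x k) := (if_pos rfl).symm
      _ ≤ _ := single_le_sum (f := fun j => letterInd (x j) (x k))
        (fun _ _ => letterInd_nonneg _ _) hk
  rw [sampleProp, one_div]
  exact le_mul_of_one_le_right (by positivity) hone

lemma sampleProp_pos {i : ℕ+} (hn : n ≠ 0) (hi : i ∈ observedLetters n x) :
    0 < sampleProp n x i :=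
  (by positivity : (0 : ℝ) < (n : ℝ)⁻¹).trans_le (inv_le_sampleProp hi)

lemma sum_observedLetters_sampleProp_mul (f : ℕ+ → ℝ) :
    ∑ i ∈ observedLetters n x, sampleProp n x i * f i = sampleMean n x f := by
  simp_rw [sampleProp, mul_assoc, ← mul_sum, sum_mul]
  rw [sum_comm, one_div_mul_eq_div, sampleMean]
  congr 1
  refine sum_congr rfl fun k hk => ?_
  simp [letterInd, mem_observedLetters hk]

lemma sampleMean_const (hn : n ≠ 0) (c : ℝ) : sampleMean n x (fun _ => c) = c := by
  have : (n : ℝ) ≠ 0 := Nat.cast_ne_zero.2 hn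
  simp [sampleMean, this]

lemma sampleMean_add (f g : ℕ+ → ℝ) :
    sampleMean n x (fun i => f i + g i) = sampleMean n x f + sampleMean n x g := by
  simp only [sampleMean, sum_add_distrib, add_div]

lemma sampleMean_sub (f g : ℕ+ → ℝ) :
    sampleMean n x (fun i => f i - g i) = sampleMean n x f - sampleMean n x g := by
  simp only [sampleMean, sum_sub_distrib, sub_div]

lemma sampleMean_const_mul (c : ℝ) (f : ℕ+ → ℝ) :
    sampleMean n x (fun i => c * f i) = c * sampleMean n x f := by
  simp only [sampleMean, ← mul_sum, mul_div_assoc]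

lemma sampleMean_mono {f g : ℕ+ → ℝ} (h : ∀ i ∈ observedLetters n x, f i ≤ g i) :
    sampleMean n x f ≤ sampleMean n x g :=
  div_le_div_of_nonneg_right (sum_le_sum fun _ hk => h _ (mem_observedLetters hk)) n.cast_nonneg

lemma shannonEntropy_eq_neg_sum {q : ℕ+ → ℝ} {s : Finset ℕ+} (hq : ∀ i ∉ s, q i = 0) :
    shannonEntropy q = -∑ i ∈ s, q i * Real.log (q i) := by
  rw [shannonEntropy, tsum_eq_sum fun i hi => by rw [hq i hi, zero_mul]]

lemma plugInEntropy_eq_neg_sum : plugInEntropy n x =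
    -∑ i ∈ observedLetters n x, sampleProp n x i * Real.log (sampleProp n x i) :=
  shannonEntropy_eq_neg_sum fun _ => sampleProp_eq_zero

lemma plugInEntropy_eq_sampleMean :
    plugInEntropy n x = sampleMean n x fun i => -Real.log (sampleProp n x i) := by
  rw [plugInEntropy_eq_neg_sum, ← sum_observedLetters_sampleProp_mul]
  simp only [mul_neg, sum_neg_distrib]

variable {p : ℕ+ → ℝ}

lemma plugInEntropy_le_sampleMean_neg_log (hn : n ≠ 0) (hpos : ∀ i ∈ observedLetters n x, 0 < p i)
    (hp : ∑ i ∈ observedLetters n x, p i ≤ 1) :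
    plugInEntropy n x ≤ sampleMean n x fun i => -Real.log (p i) := by
  have hmass : ∑ i ∈ observedLetters n x, sampleProp n x i = 1 := by
    simpa using (sum_observedLetters_sampleProp_mul fun _ => 1).trans (sampleMean_const hn 1)
  have hgibbs := sum_le_sum fun i hi => sub_le_mul_log_sub_mul_log
    (sampleProp_nonneg (n := n) (x := x) i) (hpos i hi)
  rw [sum_sub_distrib, sum_sub_distrib, hmass] at hgibbs
  rw [plugInEntropy_eq_neg_sum, ← sum_observedLetters_sampleProp_mul]
  simp only [mul_neg, sum_neg_distrib]
  linarith

lemma sampleMean_neg_log_le_plugInEntropy_add {ε : ℝ} (hn : n ≠ 0) (hε0 : 0 < ε) (hε : ε ≤ 1)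
    (hpos : ∀ i ∈ observedLetters n x, 0 < p i) :
    sampleMean n x (fun i => -Real.log (p i)) ≤ plugInEntropy n x +
      ((n : ℝ)⁻¹ ^ ε / ε * sampleMean n x (fun i => p i ^ (-ε)) +
        (sampleMean n x (fun i => sampleProp n x i / (p i + (n : ℝ)⁻¹)) - 1)) := by
  rw [plugInEntropy_eq_sampleMean, ← sampleMean_const_mul, ← sampleMean_const (x := x) hn 1,
    ← sampleMean_sub, ← sampleMean_add, ← sampleMean_add]
  exact sampleMean_mono fun i hi =>
    neg_log_le_neg_log_add (hpos i hi) (sampleProp_pos hn hi) (by positivity) hε0 hε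

lemma card_observedLetters_div_le {ε : ℝ} (hn : n ≠ 0) (hε0 : 0 ≤ ε) (hε : ε ≤ 1)
    (hpos : ∀ i ∈ observedLetters n x, 0 < p i) :
    (#(observedLetters n x) : ℝ) / n ≤ (n : ℝ)⁻¹ ^ ε *
      (∑ i ∈ observedLetters n x, p i ^ (1 - ε) + sampleMean n x fun i => p i ^ (-ε)) := by
  rw [← sum_observedLetters_sampleProp_mul, ← sum_add_distrib, mul_sum, div_eq_mul_inv,
    ← nsmul_eq_mul]
  exact card_nsmul_le_sum _ _ _ fun i hi =>
    le_rpow_mul_add (hpos i hi) (by positivity) (inv_le_sampleProp hi) hε0 hε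

end SampleMean

section Jackknife

open Finset

variable {n : ℕ} {x : ℕ → ℕ+}

lemma looSampleProp_nonneg (hn : n ≠ 0) {j : ℕ} (hj : j ∈ range n) (i : ℕ+) :
    0 ≤ looSampleProp n x j i := by
  have hn1 : (1 : ℝ) ≤ n := Nat.one_le_cast.2 (Nat.one_le_iff_ne_zero.2 hn)
  refine mul_nonneg (one_div_nonneg.2 (by linarith)) (sub_nonneg.2 ?_)
  exact single_le_sum (f := fun k => letterInd (x k) i) (fun _ _ => letterInd_nonneg _ _) hj

lemma looSampleProp_eq_zero {j : ℕ} (hj : j ∈ range n) {i : ℕ+} (hi : i ∉ observedLetters n x) :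
    looSampleProp n x j i = 0 := by
  rw [looSampleProp, sum_eq_zero fun k hk => letterInd_eq_zero hk hi, letterInd_eq_zero hj hi,
    sub_zero, mul_zero]

lemma sum_letterInd (hn : n ≠ 0) (i : ℕ+) :
    ∑ k ∈ range n, letterInd (x k) i = n * sampleProp n x i := by
  have : (n : ℝ) ≠ 0 := Nat.cast_ne_zero.2 hn
  rw [sampleProp]
  field_simp

lemma sum_looSampleProp (hn : 2 ≤ n) (i : ℕ+) :
    ∑ j ∈ range n, looSampleProp n x j i = n * sampleProp n x i := by
  have hn1 : (0 : ℝ) < n - 1 := by linarith [(Nat.ofNat_le_cast (α := ℝ)).2 hn]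
  simp only [looSampleProp, ← mul_sum, sum_sub_distrib, sum_const, card_range, nsmul_eq_mul,
    sum_letterInd (x := x) (by lia : n ≠ 0) i]
  field_simp

lemma sum_looSampleProp_sq (hn : 2 ≤ n) (i : ℕ+) :
    ∑ j ∈ range n, looSampleProp n x j i ^ 2 = n * sampleProp n x i ^ 2 +
      n * (sampleProp n x i * (1 - sampleProp n x i)) / (n - 1) ^ 2 := by
  have hn1 : (0 : ℝ) < n - 1 := by linarith [(Nat.ofNat_le_cast (α := ℝ)).2 hn]
  have hsum := sum_letterInd (x := x) (by lia : n ≠ 0) i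
  have hidem (y : ℕ+) : letterInd y i ^ 2 = letterInd y i := by simp [letterInd]
  have hsq (j : ℕ) : looSampleProp n x j i ^ 2 = (1 / ((n : ℝ) - 1)) ^ 2 *
      ((n * sampleProp n x i) ^ 2 - (2 * (n * sampleProp n x i) - 1) * letterInd (x j) i) := by
    rw [looSampleProp, hsum]
    linear_combination (1 / ((n : ℝ) - 1)) ^ 2 * hidem (x j)
  simp only [hsq, ← mul_sum, sum_sub_distrib, sum_const, card_range, nsmul_eq_mul, hsum]
  field_simp
  ring

lemma jackknifeEntropy_sub_plugInEntropy (hn : n ≠ 0) :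
    jackknifeEntropy n x - plugInEntropy n x = (n - 1) / n * ∑ i ∈ observedLetters n x,
      (∑ j ∈ range n, looSampleProp n x j i * Real.log (looSampleProp n x j i) -
        n * (sampleProp n x i * Real.log (sampleProp n x i))) := by
  have hn0 : (n : ℝ) ≠ 0 := Nat.cast_ne_zero.2 hn
  rw [jackknifeEntropy, sum_congr rfl fun j hj => shannonEntropy_eq_neg_sum fun i hi =>
    looSampleProp_eq_zero hj hi, sum_neg_distrib, sum_comm, sum_sub_distrib, ← mul_sum,
    plugInEntropy_eq_neg_sum]
  field_simp
  ring

lemma sum_looSampleProp_mul_log_sub_mem_Icc (hn : 2 ≤ n) {i : ℕ+}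
    (hi : i ∈ observedLetters n x) :
    ∑ j ∈ range n, looSampleProp n x j i * Real.log (looSampleProp n x j i) -
      n * (sampleProp n x i * Real.log (sampleProp n x i)) ∈ Set.Icc 0 (1 / ((n : ℝ) - 1)) := by
  have hn1 : (0 : ℝ) < n - 1 := by linarith [(Nat.ofNat_le_cast (α := ℝ)).2 hn]
  have hn0 : (0 : ℝ) < n := by linarith
  have hq : 0 < sampleProp n x i := sampleProp_pos (by lia) hi
  have hq1 : 1 ≤ n * sampleProp n x i := (inv_le_iff_one_le_mul₀' hn0).1 (inv_le_sampleProp hi)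
  have h := sum_mul_log_sub_card_mul_mem_Icc (s := range n)
    (fun j hj => looSampleProp_nonneg (x := x) (by lia) hj i) hq
    (by rw [card_range, sum_looSampleProp hn])
  rw [card_range, sum_looSampleProp_sq hn] at h
  refine Set.Icc_subset_Icc_right ?_ h
  calc _ = (n - n * sampleProp n x i) / (n - 1) ^ 2 := by field_simp; ring
    _ ≤ (n - 1) / (n - 1) ^ 2 := by gcongr
    _ = 1 / (n - 1) := by field_simp

lemma jackknifeEntropy_sub_plugInEntropy_mem_Icc (hn : 2 ≤ n) :
    jackknifeEntropy n x - plugInEntropy n x ∈ Set.Icc 0 ((#(observedLetters n x) : ℝ) / n) := by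
  have hn1 : (0 : ℝ) < n - 1 := by linarith [(Nat.ofNat_le_cast (α := ℝ)).2 hn]
  rw [jackknifeEntropy_sub_plugInEntropy (by lia)]
  have hgap := fun i (hi : i ∈ observedLetters n x) => sum_looSampleProp_mul_log_sub_mem_Icc hn hi
  refine ⟨mul_nonneg (by positivity) (sum_nonneg fun i hi => (hgap i hi).1), ?_⟩
  calc _ ≤ ((n : ℝ) - 1) / n * (#(observedLetters n x) • (1 / ((n : ℝ) - 1))) := by
        gcongr
        exact sum_le_card_nsmul _ _ _ fun i hi => (hgap i hi).2
    _ = (#(observedLetters n x) : ℝ) / n := by rw [nsmul_eq_mul]; field_simp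

theorem abs_jackknifeEntropy_sub_sampleMean_le {p : ℕ+ → ℝ} {ε S : ℝ} (hn : 2 ≤ n) (hε0 : 0 < ε)
    (hε : ε ≤ 1) (hpos : ∀ i ∈ observedLetters n x, 0 < p i)
    (hp : ∑ i ∈ observedLetters n x, p i ≤ 1)
    (hS : ∑ i ∈ observedLetters n x, p i ^ (1 - ε) ≤ S) :
    |jackknifeEntropy n x - sampleMean n x fun i => -Real.log (p i)| ≤
      (n : ℝ)⁻¹ ^ ε * (S + (1 + 1 / ε) * sampleMean n x fun i => p i ^ (-ε)) +
        (sampleMean n x (fun i => sampleProp n x i / (p i + (n : ℝ)⁻¹)) - 1) := by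
  have hn0 : n ≠ 0 := by lia
  set M := sampleMean n x fun i => p i ^ (-ε)
  obtain ⟨hcorr0, hcorr⟩ := jackknifeEntropy_sub_plugInEntropy_mem_Icc (x := x) hn
  have hdeficit0 := plugInEntropy_le_sampleMean_neg_log hn0 hpos hp
  have hdeficit := sampleMean_neg_log_le_plugInEntropy_add hn0 hε0 hε hpos
  have hcard : (#(observedLetters n x) : ℝ) / n ≤ (n : ℝ)⁻¹ ^ ε * (S + M) :=
    (card_observedLetters_div_le hn0 hε0.le hε hpos).trans (by gcongr)
  have hsplit : (n : ℝ)⁻¹ ^ ε * (S + (1 + 1 / ε) * M) =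
      (n : ℝ)⁻¹ ^ ε * (S + M) + (n : ℝ)⁻¹ ^ ε / ε * M := by ring
  rw [hsplit, abs_sub_le_iff]
  constructor <;> linarith

end Jackknife

section DiscreteVariables

variable {Ω α : Type*} [MeasurableSpace Ω] {μ : Measure Ω} [MeasurableSpace α]
  [DiscreteMeasurableSpace α] {Y : Ω → α} {p : α → ℝ}

lemma measureReal_map_singleton (hY : Measurable Y) (hp : ∀ i, μ.real {ω | Y ω = i} = p i)
    (i : α) : (μ.map Y).real {i} = p i :=
  (map_measureReal_apply hY (measurableSet_singleton i)).trans (hp i)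

variable [IsFiniteMeasure μ] [Countable α]

lemma integrable_comp_iff_summable (hY : Measurable Y) (hp : ∀ i, μ.real {ω | Y ω = i} = p i)
    (f : α → ℝ) : Integrable (fun ω => f (Y ω)) μ ↔ Summable fun i => p i * |f i| := by
  have hmap := integrable_map_measure (μ := μ) (g := f)
    (Measurable.of_discrete.aestronglyMeasurable) hY.aemeasurable
  simp_rw [← measureReal_map_singleton hY hp]
  refine hmap.symm.trans ?_
  rw [← Measure.sum_smul_dirac (μ.map Y), integrable_sum_dirac_iff fun i => measure_ne_top _ _,
    Measure.sum_smul_dirac]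
  rfl

lemma integral_comp_eq_tsum (hY : Measurable Y) (hp : ∀ i, μ.real {ω | Y ω = i} = p i)
    (f : α → ℝ) : ∫ ω, f (Y ω) ∂μ = ∑' i, p i * f i := by
  simp_rw [← measureReal_map_singleton hY hp]
  rw [← integral_map hY.aemeasurable Measurable.of_discrete.aestronglyMeasurable,
    ← Measure.sum_smul_dirac (μ.map Y), integral_sum_dirac fun i => measure_ne_top _ _,
    Measure.sum_smul_dirac]
  rfl

lemma identDistrib_of_measureReal_singleton {Z : Ω → α} (hY : Measurable Y) (hZ : Measurable Z)
    (hYp : ∀ i, μ.real {ω | Y ω = i} = p i) (hZp : ∀ i, μ.real {ω | Z ω = i} = p i) :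
    IdentDistrib Y Z μ μ where
  aemeasurable_fst := hY.aemeasurable
  aemeasurable_snd := hZ.aemeasurable
  map_eq := Measure.ext_of_singleton fun i =>
    (measureReal_eq_measureReal_iff).1 <|
      (measureReal_map_singleton hY hYp i).trans (measureReal_map_singleton hZ hZp i).symm

lemma integral_ite_eq_of_indepFun {Z : Ω → α} (hY : Measurable Y) (hZ : Measurable Z)
    (hYZ : IndepFun Y Z μ) (hp : ∀ i, μ.real {ω | Y ω = i} = p i) {f : α → ℝ} {c : ℝ}
    (hf : ∀ i, |f i| ≤ c) [DecidableEq α] :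
    ∫ ω, (if Y ω = Z ω then 1 else 0) * f (Z ω) ∂μ = ∫ ω, p (Z ω) * f (Z ω) ∂μ := by
  let g (y : α × α) : ℝ := (if y.1 = y.2 then 1 else 0) * f y.2
  have hg (y : α × α) : ‖g y‖ ≤ c := by
    refine (le_trans ?_ (hf y.2))
    simp only [g, Real.norm_eq_abs]
    split_ifs <;> simp
  have hinner (b : α) : ∫ a, g (a, b) ∂μ.map Y = p b * f b := by
    have : (fun a => g (a, b)) = ({b} : Set α).indicator fun _ => f b := by
      ext a
      simp [g, Set.indicator_apply]
    rw [this, integral_indicator_const _ (measurableSet_singleton b),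
      measureReal_map_singleton hY hp, smul_eq_mul]
  calc ∫ ω, g (Y ω, Z ω) ∂μ = ∫ y, g y ∂(μ.map Y).prod (μ.map Z) := by
        rw [← (indepFun_iff_map_prod_eq_prod_map_map hY.aemeasurable hZ.aemeasurable).1 hYZ,
          integral_map (hY.prodMk hZ).aemeasurable Measurable.of_discrete.aestronglyMeasurable]
    _ = ∫ b, p b * f b ∂μ.map Z := by
        rw [integral_prod_symm _ (Integrable.of_bound
          Measurable.of_discrete.aestronglyMeasurable c (ae_of_all _ hg))]
        simp only [hinner]
    _ = ∫ ω, p (Z ω) * f (Z ω) ∂μ :=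
        integral_map hZ.aemeasurable Measurable.of_discrete.aestronglyMeasurable

end DiscreteVariables

lemma ae_pos_comp {Ω α : Type*} [MeasurableSpace Ω] {μ : Measure Ω} [IsFiniteMeasure μ]
    [Countable α] {Y : Ω → α} {p : α → ℝ} (hp : ∀ i, μ.real {ω | Y ω = i} = p i) :
    ∀ᵐ ω ∂μ, 0 < p (Y ω) := by
  have hne : ∀ᵐ ω ∂μ, ∀ i, p i = 0 → Y ω ≠ i := by
    refine ae_all_iff.2 fun i => ?_
    by_cases hi : p i = 0
    · rw [← hp i, measureReal_eq_zero_iff] at hi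
      filter_upwards [measure_eq_zero_iff_ae_notMem.1 hi] with ω hω _ using hω
    · exact ae_of_all _ fun ω h => absurd h hi
  filter_upwards [hne] with ω hω
  exact (hp (Y ω) ▸ measureReal_nonneg : 0 ≤ p (Y ω)).lt_of_ne fun h => hω _ h.symm rfl

section Sample

open Finset

instance instDiscreteMeasurableSpaceLetters : DiscreteMeasurableSpace ℕ+ := ⟨fun _ => trivial⟩

variable {Ω : Type*} [MeasurableSpace Ω] {μ : Measure Ω} [IsProbabilityMeasure μ]
  {X : ℕ → Ω → ℕ+} {p : ℕ+ → ℝ}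

lemma letter_prob_mem_Icc (hp : ∀ k i, μ.real {ω | X k ω = i} = p i) (i : ℕ+) :
    p i ∈ Set.Icc 0 1 :=
  hp 0 i ▸ ⟨measureReal_nonneg, measureReal_le_one⟩

lemma letter_prob_mul_rpow_neg (hp : ∀ k i, μ.real {ω | X k ω = i} = p i) {ε : ℝ} (hε : ε ≠ 1)
    (i : ℕ+) : p i * p i ^ (-ε) = p i ^ (1 - ε) := by
  rw [sub_eq_add_neg, Real.rpow_one_add' (letter_prob_mem_Icc hp i).1]
  rwa [← sub_eq_add_neg, sub_ne_zero, ne_comm]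

lemma sum_letter_prob_le_one (hX : ∀ k, Measurable (X k))
    (hp : ∀ k i, μ.real {ω | X k ω = i} = p i) (s : Finset ℕ+) : ∑ i ∈ s, p i ≤ 1 := by
  have := Measure.isProbabilityMeasure_map (μ := μ) (hX 0).aemeasurable
  simp_rw [← measureReal_map_singleton (hX 0) (hp 0)]
  exact (sum_measureReal_singleton s).trans_le measureReal_le_one

lemma identDistrib_letters (hX : ∀ k, Measurable (X k))
    (hp : ∀ k i, μ.real {ω | X k ω = i} = p i) (f : ℕ+ → ℝ) (k : ℕ) :
    IdentDistrib (fun ω => f (X k ω)) (fun ω => f (X 0 ω)) μ μ :=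
  (identDistrib_of_measureReal_singleton (hX k) (hX 0) (hp k) (hp 0)).comp Measurable.of_discrete

lemma integrable_sampleMean (hX : ∀ k, Measurable (X k))
    (hp : ∀ k i, μ.real {ω | X k ω = i} = p i) {f : ℕ+ → ℝ} (hf : Summable fun i => p i * |f i|)
    (n : ℕ) : Integrable (fun ω => sampleMean n (fun k => X k ω) f) μ :=
  (integrable_finsetSum _ fun k _ =>
    (integrable_comp_iff_summable (hX k) (hp k) f).2 hf).div_const _

lemma integral_sampleMean (hX : ∀ k, Measurable (X k))
    (hp : ∀ k i, μ.real {ω | X k ω = i} = p i) {f : ℕ+ → ℝ} (hf : Summable fun i => p i * |f i|)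
    {n : ℕ} (hn : n ≠ 0) :
    ∫ ω, sampleMean n (fun k => X k ω) f ∂μ = ∑' i, p i * f i := by
  have hn0 : (n : ℝ) ≠ 0 := Nat.cast_ne_zero.2 hn
  simp only [sampleMean]
  rw [integral_div, integral_finsetSum _ fun k _ =>
    (integrable_comp_iff_summable (hX k) (hp k) f).2 hf]
  simp_rw [fun k => integral_comp_eq_tsum (hX k) (hp k) f]
  simp [hn0]

lemma integral_letterInd_mul_le (hX : ∀ k, Measurable (X k)) (hindep : iIndepFun X μ)
    (hp : ∀ k i, μ.real {ω | X k ω = i} = p i) {f : ℕ+ → ℝ} {c : ℝ} (hf0 : 0 ≤ f)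
    (hf : ∀ i, f i ≤ c) (j k : ℕ) :
    ∫ ω, letterInd (X j ω) (X k ω) * f (X k ω) ∂μ ≤
      ∑' i, p i * (p i * f i) + if j = k then ∑' i, p i * f i else 0 := by
  split_ifs with hjk
  · subst hjk
    simp only [letterInd, if_true, one_mul]
    rw [integral_comp_eq_tsum (hX j) (hp j)]
    exact le_add_of_nonneg_left (tsum_nonneg fun i =>
      have := (letter_prob_mem_Icc hp i).1
      mul_nonneg this (mul_nonneg this (hf0 i)))
  · rw [add_zero, ← integral_comp_eq_tsum (hX k) (hp k) fun i => p i * f i]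
    exact (integral_ite_eq_of_indepFun (hX j) (hX k) (hindep.indepFun hjk) (hp j)
      fun i => (abs_of_nonneg (hf0 i)).trans_le (hf i)).le

lemma sampleMean_sampleProp_mul {n : ℕ} {x : ℕ → ℕ+} (f : ℕ+ → ℝ) :
    sampleMean n x (fun i => sampleProp n x i * f i) =
      (∑ k ∈ range n, ∑ j ∈ range n, letterInd (x j) (x k) * f (x k)) / (n : ℝ) ^ 2 := by
  simp only [sampleMean, sampleProp, mul_assoc, ← mul_sum, sum_mul]
  ring

lemma summable_letter_prob_mul (hX : ∀ k, Measurable (X k))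
    (hp : ∀ k i, μ.real {ω | X k ω = i} = p i) {f : ℕ+ → ℝ} {c : ℝ} (hf : ∀ i, |f i| ≤ c) :
    Summable fun i => p i * |f i| :=
  (integrable_comp_iff_summable (hX 0) (hp 0) f).1 <|
    .of_bound (Measurable.of_discrete.comp (hX 0)).aestronglyMeasurable c
      (ae_of_all _ fun ω => hf (X 0 ω))

lemma integrable_letterInd_mul (hX : ∀ k, Measurable (X k)) {f : ℕ+ → ℝ} {c : ℝ}
    (hf : ∀ i, |f i| ≤ c) (j k : ℕ) :
    Integrable (fun ω => letterInd (X j ω) (X k ω) * f (X k ω)) μ := by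
  have hmeas : Measurable fun y : ℕ+ × ℕ+ => letterInd y.1 y.2 * f y.2 := .of_discrete
  refine .of_bound (hmeas.comp ((hX j).prodMk (hX k))).aestronglyMeasurable c
    (ae_of_all _ fun ω => (?_ : _ ≤ |f (X k ω)|).trans (hf _))
  rw [Real.norm_eq_abs, abs_mul]
  refine mul_le_of_le_one_left (abs_nonneg _) ?_
  unfold letterInd
  split_ifs <;> simp

lemma integrable_sampleMean_sampleProp_mul (hX : ∀ k, Measurable (X k)) {f : ℕ+ → ℝ} {c : ℝ}
    (hf : ∀ i, |f i| ≤ c) (n : ℕ) :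
    Integrable (fun ω => sampleMean n (fun k => X k ω)
      fun i => sampleProp n (fun k => X k ω) i * f i) μ := by
  simp_rw [sampleMean_sampleProp_mul]
  exact (integrable_finsetSum _ fun k _ => integrable_finsetSum _ fun j _ =>
    integrable_letterInd_mul hX hf j k).div_const _

/-- The diagonal terms `letterInd (X k ω) (X k ω)` contribute the summand `(n : ℝ)⁻¹`. -/
lemma integral_sampleMean_sampleProp_mul_le (hX : ∀ k, Measurable (X k)) (hindep : iIndepFun X μ)
    (hp : ∀ k i, μ.real {ω | X k ω = i} = p i) {f : ℕ+ → ℝ} {c : ℝ} (hf0 : 0 ≤ f)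
    (hf : ∀ i, f i ≤ c) {n : ℕ} (hn : n ≠ 0) :
    ∫ ω, sampleMean n (fun k => X k ω) (fun i => sampleProp n (fun k => X k ω) i * f i) ∂μ ≤
      ∑' i, p i * ((p i + (n : ℝ)⁻¹) * f i) := by
  have hn0 : (n : ℝ) ≠ 0 := Nat.cast_ne_zero.2 hn
  have hpi := letter_prob_mem_Icc hp
  have hsum {g : ℕ+ → ℝ} (hg0 : 0 ≤ g) (hg : ∀ i, g i ≤ c) : Summable fun i => p i * g i := by
    simpa only [abs_of_nonneg (hg0 _)] using
      summable_letter_prob_mul hX hp fun i => (abs_of_nonneg (hg0 i)).trans_le (hg i)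
  have hsum_sq : Summable fun i => p i * (p i * f i) :=
    hsum (fun i => mul_nonneg (hpi i).1 (hf0 i))
      fun i => (mul_le_of_le_one_left (hf0 i) (hpi i).2).trans (hf i)
  have hint (j k : ℕ) := integrable_letterInd_mul (μ := μ) hX
    (fun i => (abs_of_nonneg (hf0 i)).trans_le (hf i)) j k
  simp_rw [sampleMean_sampleProp_mul]
  rw [integral_div, integral_finsetSum _ fun k _ => integrable_finsetSum _ fun j _ => hint j k]
  simp_rw [integral_finsetSum _ fun j _ => hint j _]
  calc _ ≤ (∑ k ∈ range n, ∑ j ∈ range n,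
          (∑' i, p i * (p i * f i) + if j = k then ∑' i, p i * f i else 0)) / (n : ℝ) ^ 2 := by
        gcongr
        exact integral_letterInd_mul_le hX hindep hp hf0 hf _ _
    _ = ∑' i, p i * (p i * f i) + (n : ℝ)⁻¹ * ∑' i, p i * f i := by
        simp only [sum_add_distrib, sum_ite_eq', sum_ite_mem, inter_self, sum_const, card_range,
          nsmul_eq_mul]
        field_simp
    _ = _ := by
        rw [← tsum_mul_left, ← hsum_sq.tsum_add ((hsum hf0 hf).mul_left _)]
        exact tsum_congr fun i => by ring

lemma summable_letter_prob_mul_rpow_neg (hp : ∀ k i, μ.real {ω | X k ω = i} = p i) {ε : ℝ}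
    (hε : ε ≠ 1) (hsum : Summable fun i => p i ^ (1 - ε)) :
    Summable fun i => p i * |p i ^ (-ε)| := by
  refine hsum.congr fun i => ?_
  have hpi := (letter_prob_mem_Icc hp i).1
  rw [abs_of_nonneg (Real.rpow_nonneg hpi _), letter_prob_mul_rpow_neg hp hε]

lemma memLp_log_letter_prob (hX : ∀ k, Measurable (X k))
    (hp : ∀ k i, μ.real {ω | X k ω = i} = p i) {ε r : ℝ} (hε : 0 < ε) (hε1 : ε < 1)
    (hsum : Summable fun i => p i ^ (1 - ε)) (hr : 0 < r) (k : ℕ) :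
    MemLp (fun ω => Real.log (p (X k ω))) (ENNReal.ofReal r) μ := by
  have hmeas : AEStronglyMeasurable (fun ω => Real.log (p (X k ω))) μ :=
    (Measurable.of_discrete.comp (hX k) (g := fun i => Real.log (p i))).aestronglyMeasurable
  rw [← integrable_norm_rpow_iff hmeas (by simpa using hr) ENNReal.ofReal_ne_top,
    ENNReal.toReal_ofReal hr.le]
  have hdom := (integrable_comp_iff_summable (hX k) (hp k) fun i => p i ^ (-ε)).2
    (summable_letter_prob_mul_rpow_neg hp hε1.ne hsum)
  refine (hdom.const_mul ((r / ε) ^ r)).mono' (by fun_prop (disch := exact hr.le))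
    (ae_of_all _ fun ω => ?_)
  obtain ⟨hp0, hp1⟩ := letter_prob_mem_Icc hp (X k ω)
  rw [Real.norm_of_nonneg (by positivity)]
  exact abs_log_rpow_le hp0 hp1 hr hε

lemma variance_log_letter_prob_ne_zero (hp : ∀ k i, μ.real {ω | X k ω = i} = p i)
    (hnonunif : IsNonuniform p) (hL : MemLp (fun ω => Real.log (p (X 0 ω))) 2 μ) :
    Var[fun ω => Real.log (p (X 0 ω)); μ] ≠ 0 := by
  intro hzero
  have hconst : (fun ω => Real.log (p (X 0 ω))) =ᵐ[μ] fun _ => ∫ ω, Real.log (p (X 0 ω)) ∂μ := by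
    rw [← evariance_eq_zero_iff hL.aestronglyMeasurable.aemeasurable, ← ofReal_variance hL, hzero,
      ENNReal.ofReal_zero]
  have hmean (i : ℕ+) (hi : p i ≠ 0) : Real.log (p i) = ∫ ω, Real.log (p (X 0 ω)) ∂μ := by
    by_contra hne
    refine hi ?_
    rw [← hp 0 i, measureReal_eq_zero_iff]
    exact measure_mono_null (fun ω (hω : X 0 ω = i) => by simpa [hω] using hne) (ae_iff.1 hconst)
  obtain ⟨i, j, hi, hj, hij⟩ := hnonunif
  have hpos (i : ℕ+) (hi : p i ≠ 0) : 0 < p i := (letter_prob_mem_Icc hp i).1.lt_of_ne' hi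
  exact hij <| Real.log_injOn_pos (hpos i hi) (hpos j hj) ((hmean i hi).trans (hmean j hj).symm)

lemma sqrt_variance_log_letter_prob_pos (hX : ∀ k, Measurable (X k))
    (hp : ∀ k i, μ.real {ω | X k ω = i} = p i) (hnonunif : IsNonuniform p) {ε : ℝ} (hε0 : 0 < ε)
    (hε : ε < 1) (hsum : Summable fun i => p i ^ (1 - ε)) :
    0 < √(Var[fun ω => Real.log (p (X 0 ω)); μ]) := by
  have hL : MemLp (fun ω => Real.log (p (X 0 ω))) 2 μ := by
    simpa using memLp_log_letter_prob hX hp hε0 hε hsum two_pos 0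
  exact Real.sqrt_pos.2
    ((variance_nonneg _ _).lt_of_ne' (variance_log_letter_prob_ne_zero hp hnonunif hL))

lemma letter_prob_add_inv_pos (hp : ∀ k i, μ.real {ω | X k ω = i} = p i) {n : ℕ} (hn : n ≠ 0)
    (i : ℕ+) : 0 < p i + (n : ℝ)⁻¹ :=
  add_pos_of_nonneg_of_pos (letter_prob_mem_Icc hp i).1 (by positivity)

lemma abs_inv_letter_prob_add_inv_le (hp : ∀ k i, μ.real {ω | X k ω = i} = p i) {n : ℕ}
    (hn : n ≠ 0) (i : ℕ+) : |(p i + (n : ℝ)⁻¹)⁻¹| ≤ n := by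
  rw [abs_of_pos (inv_pos.2 (letter_prob_add_inv_pos hp hn i)),
    inv_le_comm₀ (letter_prob_add_inv_pos hp hn i) (by positivity)]
  exact le_add_of_nonneg_left (letter_prob_mem_Icc hp i).1

lemma integral_sampleMean_sampleProp_div_le_one (hX : ∀ k, Measurable (X k))
    (hindep : iIndepFun X μ) (hp : ∀ k i, μ.real {ω | X k ω = i} = p i) {n : ℕ} (hn : n ≠ 0) :
    ∫ ω, sampleMean n (fun k => X k ω)
      (fun i => sampleProp n (fun k => X k ω) i / (p i + (n : ℝ)⁻¹)) ∂μ ≤ 1 := by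
  have hpos := letter_prob_add_inv_pos hp hn
  calc _ ≤ ∑' i, p i * ((p i + (n : ℝ)⁻¹) * (p i + (n : ℝ)⁻¹)⁻¹) := by
        simp_rw [div_eq_mul_inv]
        exact integral_sampleMean_sampleProp_mul_le hX hindep hp
          (fun i => inv_nonneg.2 (hpos i).le)
          (fun i => (le_abs_self _).trans (abs_inv_letter_prob_add_inv_le hp hn i)) hn
    _ = ∑' i, p i := tsum_congr fun i => by rw [mul_inv_cancel₀ (hpos i).ne', mul_one]
    _ ≤ 1 := Real.tsum_le_of_sum_le (fun i => (letter_prob_mem_Icc hp i).1)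
        (sum_letter_prob_le_one hX hp)

lemma ae_abs_jackknifeEntropy_sub_sampleMean_le (hX : ∀ k, Measurable (X k))
    (hp : ∀ k i, μ.real {ω | X k ω = i} = p i) {ε : ℝ} (hε0 : 0 < ε) (hε : ε ≤ 1)
    (hsum : Summable fun i => p i ^ (1 - ε)) {n : ℕ} (hn : 2 ≤ n) :
    ∀ᵐ ω ∂μ, |jackknifeEntropy n (fun k => X k ω) -
        sampleMean n (fun k => X k ω) fun i => -Real.log (p i)| ≤
      (n : ℝ)⁻¹ ^ ε * (∑' i, p i ^ (1 - ε) +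
        (1 + 1 / ε) * sampleMean n (fun k => X k ω) fun i => p i ^ (-ε)) +
      (sampleMean n (fun k => X k ω)
        (fun i => sampleProp n (fun k => X k ω) i / (p i + (n : ℝ)⁻¹)) - 1) := by
  filter_upwards [ae_all_iff.2 fun k => ae_pos_comp (μ := μ) (hp k)] with ω hω
  refine abs_jackknifeEntropy_sub_sampleMean_le hn hε0 hε (fun i hi => ?_)
    (sum_letter_prob_le_one hX hp _)
    (hsum.sum_le_tsum _ fun i _ => Real.rpow_nonneg (letter_prob_mem_Icc hp i).1 _)
  obtain ⟨k, -, rfl⟩ := mem_image.1 hi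
  exact hω k

lemma measureReal_lt_abs_jackknifeEntropy_sub_sampleMean_le (hX : ∀ k, Measurable (X k))
    (hindep : iIndepFun X μ) (hp : ∀ k i, μ.real {ω | X k ω = i} = p i) {ε : ℝ} (hε0 : 0 < ε)
    (hε : ε < 1) (hsum : Summable fun i => p i ^ (1 - ε)) {n : ℕ} (hn : 2 ≤ n) {η : ℝ}
    (hη : 0 < η) :
    μ.real {ω | η < |jackknifeEntropy n (fun k => X k ω) -
        sampleMean n (fun k => X k ω) fun i => -Real.log (p i)|} ≤
      (n : ℝ)⁻¹ ^ ε * ((2 + 1 / ε) * ∑' i, p i ^ (1 - ε)) / η := by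
  have hn0 : n ≠ 0 := by lia
  have hpow := summable_letter_prob_mul_rpow_neg hp hε.ne hsum
  have hpow_mean := integral_sampleMean hX hp hpow hn0
  simp only [letter_prob_mul_rpow_neg hp hε.ne] at hpow_mean
  have hpow_int := integrable_sampleMean hX hp hpow n
  have hratio_mean := integral_sampleMean_sampleProp_div_le_one hX hindep hp hn0
  have hratio_int := integrable_sampleMean_sampleProp_mul (μ := μ) hX
    (abs_inv_letter_prob_add_inv_le hp hn0) n
  simp only [← div_eq_mul_inv] at hratio_int
  refine (measureReal_lt_le_integral_div (ae_of_all _ fun ω => abs_nonneg _)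
    (ae_abs_jackknifeEntropy_sub_sampleMean_le hX hp hε0 hε.le hsum hn) (by fun_prop) hη).trans ?_
  gcongr
  rw [integral_add (by fun_prop) (by fun_prop), integral_sub hratio_int (by fun_prop),
    integral_const_mul, integral_add (by fun_prop) (by fun_prop), integral_const_mul, hpow_mean,
    integral_const, integral_const, probReal_univ, one_smul, one_smul]
  linarith

lemma exists_measureReal_lt_scaled_jackknifeEntropy_sub_le (hX : ∀ k, Measurable (X k))
    (hindep : iIndepFun X μ) (hp : ∀ k i, μ.real {ω | X k ω = i} = p i) {ε : ℝ} (hε0 : 0 < ε)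
    (hε : ε < 1) (hsum : Summable fun i => p i ^ (1 - ε)) {σ : ℝ} (hσ : 0 < σ) :
    ∃ D, ∀ n : ℕ, 2 ≤ n →
      μ.real {ω | (n : ℝ) ^ (1 / 4 - ε / 2) <
        |√n / σ * (jackknifeEntropy n (fun k => X k ω) - shannonEntropy p) -
          √n / σ * (sampleMean n (fun k => X k ω) (fun i => -Real.log (p i)) -
            shannonEntropy p)|} ≤ D * (n : ℝ) ^ (1 / 4 - ε / 2) := by
  refine ⟨(2 + 1 / ε) * (∑' i, p i ^ (1 - ε)) / σ, fun n hn => ?_⟩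
  have hn0 : (0 : ℝ) < n := Nat.cast_pos.2 (by lia)
  set η := (n : ℝ) ^ (1 / 4 - ε / 2)
  have hη_sq : √n * (n : ℝ)⁻¹ ^ ε = η * η := by
    rw [Real.sqrt_eq_rpow, Real.inv_rpow hn0.le, ← Real.rpow_neg hn0.le, ← Real.rpow_add hn0,
      ← Real.rpow_add hn0]
    ring_nf
  have hscale (a b : ℝ) : η < |√n / σ * (a - shannonEntropy p) - √n / σ * (b - shannonEntropy p)| ↔
      η / (√n / σ) < |a - b| := by
    rw [← mul_sub, sub_sub_sub_cancel_right, abs_mul, abs_of_pos (by positivity),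
      div_lt_iff₀' (by positivity)]
  simp only [hscale]
  refine (measureReal_lt_abs_jackknifeEntropy_sub_sampleMean_le hX hindep hp hε0 hε hsum hn
    (by positivity)).trans_eq ?_
  calc _ = √n * (n : ℝ)⁻¹ ^ ε * ((2 + 1 / ε) * ∑' i, p i ^ (1 - ε)) / (σ * η) := by
        field_simp
    _ = _ := by rw [hη_sq]; field_simp

lemma exists_abs_measureReal_sampleMean_neg_log_le (hX : ∀ k, Measurable (X k))
    (hindep : iIndepFun X μ) (hp : ∀ k i, μ.real {ω | X k ω = i} = p i)
    (hnonunif : IsNonuniform p) {ε : ℝ} (hε0 : 0 < ε) (hε : ε < 1)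
    (hsum : Summable fun i => p i ^ (1 - ε)) :
    ∃ C, ∀ n : ℕ, n ≠ 0 → ∀ x,
      |μ.real {ω | √n / √(Var[fun ω => Real.log (p (X 0 ω)); μ]) *
          (sampleMean n (fun k => X k ω) (fun i => -Real.log (p i)) - shannonEntropy p) ≤ x} -
        cdf (gaussianReal 0 1) x| ≤ C * (n : ℝ) ^ (-(1 / 4) : ℝ) := by
  have hvar : Var[fun ω => -Real.log (p (X 0 ω)); μ] = Var[fun ω => Real.log (p (X 0 ω)); μ] :=
    variance_fun_neg
  have hmean : ∫ ω, -Real.log (p (X 0 ω)) ∂μ = shannonEntropy p := by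
    rw [integral_neg, integral_comp_eq_tsum (hX 0) (hp 0) fun i => Real.log (p i), shannonEntropy]
  obtain ⟨C, hC⟩ := berry_esseen (μ := μ) (ξ := fun k ω => -Real.log (p (X k ω))) (δ := 1 / 2)
    (hindep.comp (fun _ i => -Real.log (p i)) fun _ => .of_discrete)
    (identDistrib_letters hX hp fun i => -Real.log (p i)) (by norm_num) le_rfl
    (memLp_log_letter_prob hX hp hε0 hε hsum (by norm_num) 0).neg
    (hvar ▸ (Real.sqrt_pos.1 (sqrt_variance_log_letter_prob_pos hX hp hnonunif hε0 hε hsum)).ne')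
  rw [hvar, hmean] at hC
  refine ⟨C, fun n hn x => (hC n hn x).trans_eq ?_⟩
  norm_num

end Sample

theorem theorem3p3_general {Ω : Type*} [MeasurableSpace Ω] (μ : Measure Ω)
    [IsProbabilityMeasure μ] (X : ℕ → Ω → ℕ+) (hX : ∀ k, Measurable (X k))
    (hindep : iIndepFun X μ) (p : ℕ+ → ℝ) (hp : ∀ k i, μ.real {ω | X k ω = i} = p i)
    (hnonunif : IsNonuniform p) (ε : ℝ) (hε0 : 0 < ε) (hε : ε < 1)
    (hsum : Summable fun i => p i ^ (1 - ε)) :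
    ∃ C : ℝ, ∀ n : ℕ, 2 ≤ n → ∀ x : ℝ,
      |μ.real {ω | √n / √(Var[fun ω => Real.log (p (X 0 ω)); μ]) *
          (jackknifeEntropy n (fun k => X k ω) - shannonEntropy p) ≤ x} -
        cdf (gaussianReal 0 1) x| ≤ C * (n : ℝ) ^ (1 / 4 - ε / 2) := by
  obtain ⟨C, hC⟩ := exists_abs_measureReal_sampleMean_neg_log_le hX hindep hp hnonunif hε0 hε hsum
  obtain ⟨D, hD⟩ := exists_measureReal_lt_scaled_jackknifeEntropy_sub_le hX hindep hp hε0 hε hsum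
    (sqrt_variance_log_letter_prob_pos hX hp hnonunif hε0 hε hsum)
  refine ⟨|C| + D + 1, fun n hn x => ?_⟩
  have hn1 : (1 : ℝ) ≤ n := Nat.one_le_cast.2 (by lia)
  refine (abs_measureReal_le_sub_cdf_le_of_perturbation (η := (n : ℝ) ^ (1 / 4 - ε / 2))
    (by positivity) (hC n (by lia)) (hD n hn) x).trans ?_
  calc C * (n : ℝ) ^ (-(1 / 4) : ℝ) + D * (n : ℝ) ^ (1 / 4 - ε / 2) + (n : ℝ) ^ (1 / 4 - ε / 2)
    _ ≤ |C| * (n : ℝ) ^ (1 / 4 - ε / 2) + D * (n : ℝ) ^ (1 / 4 - ε / 2) +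
          (n : ℝ) ^ (1 / 4 - ε / 2) := by
        gcongr
        · exact le_abs_self C
        · linarith
    _ = _ := by ring

/-- `X 0, X 1, X 2, …` are the observations `X₁, X₂, X₃, …`, and the letters of the alphabet
are labelled by the positive integers. -/
theorem theorem3p3
    {Ω : Type*} [MeasurableSpace Ω] (μ : Measure Ω) [IsProbabilityMeasure μ]
    (X : ℕ → Ω → ℕ+) (hX : ∀ k, Measurable (X k)) (hindep : iIndepFun X μ)
    (p : ℕ+ → ℝ) (hp : ∀ k i, μ.real {ω | X k ω = i} = p i) (hnonunif : IsNonuniform p)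
    (δ : ℝ) (hδ0 : 0 < δ) (hδ : δ < 1 / 2)
    (hmoment : Integrable (fun ω => |Real.log (p (X 0 ω))| ^ (2 + δ)) μ)
    (K : ℕ → ℤ) (C₀ : ℝ)
    (hK : ∀ n : ℕ, 1 ≤ n → (K n : ℝ) ≤ (n : ℝ) ^ (1 / 2 - δ))
    (hK1 : ∀ n : ℕ, 1 ≤ n →
      (n : ℝ) ^ (1 / 2 + δ) * Real.log n * tailSum (K n) p ≤ C₀)
    (hK2 : ∀ n : ℕ, 1 ≤ n →
      -(n : ℝ) ^ (1 / 2 + δ) * tailSum (K n) (fun i => p i * Real.log (p i)) ≤ C₀)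
    (ε : ℝ) (hε0 : 1 / 2 < ε) (hε : ε < 1)
    (hsum : Summable fun i => p i ^ (1 - ε)) :
    ∃ C : ℝ, ∀ n : ℕ, 2 ≤ n → ∀ x : ℝ,
      |μ.real {ω | √(n : ℝ) / √(Var[fun ω => Real.log (p (X 0 ω)); μ]) *
            (jackknifeEntropy n (fun k => X k ω) - shannonEntropy p) ≤ x}
          - cdf (gaussianReal 0 1) x|
        ≤ C * (n : ℝ) ^ (-δ / 2) + C * (n : ℝ) ^ (1 / 4 - ε / 2) := by
  obtain ⟨C, hC⟩ := theorem3p3_general μ X hX hindep p hp hnonunif ε (by linarith) hε hsum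
  exact ⟨|C|, fun n hn x => (hC n hn x).trans <|
    (mul_le_mul_of_nonneg_right (le_abs_self C) (by positivity)).trans
      (le_add_of_nonneg_left (by positivity))⟩
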